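/- Let $\Bbbk$ be a field. Let $A$ be the (non-unital) zig-zag algebra over $\Bbbk$: the quotient of the path algebra of the quiver with vertex set $\mathbb Z$ and arrows $(r|r+1)\colon r\to r+1$ and $(r|r-1)\colon r\to r-1$, with product the concatenation of paths, by the relations $(r|r+1|r+2)=0$, $(r|r-1|r-2)=0$ and $(r|r-1|r)=(r|r+1|r)$, $r\in\mathbb Z$. It is graded by $\deg (r)=\deg (r|r+1)=0$ and $\deg (r|r-1)=1$, where $(r)$ denotes the idempotent at the vertex $r$. A graded $A$-module is a $\Bbbk$-vector space $M=\bigoplus_{j}M^j$ with an action of $A$, compatible with the gradings, such that $M=\bigoplus_{r}(r)M$; a path from $r$ to $s$ acts as a map $(r)M\to(s)M$, and a concatenation $xy$ acts as $x$ followed by $y$. Morphisms are the degree-preserving $A$-linear maps. Graded dg modules over $(A,d)$, with $A$ in homological degree $0$, are the same as cochain complexes $M=(M_k,d)_{k\in\mathbb Z}$ of graded $A$-modules. Let $\mathcal C(A\text{-pmod})$ be the homotopy category of (unbounded) complexes of graded projective $A$-modules, with its usual shift $[1]$, $(M[1])_k=M_{k+1}$ with differential $-d$, and its usual distinguished triangles.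 Let $\mathcal M_3$ be the category of tricomplexes, that is, of trigraded vector spaces $M=\bigoplus_{(i,j,k)\in\mathbb Z^3}M_{i,j,k}$ with maps $\partial_1,\partial_2,\partial_3$ of degrees $(1,0,0),(0,1,0),(0,0,1)$ such that $\partial_a^2=0$ and $\partial_a\partial_b+\partial_b\partial_a=0$ for $a\neq b$; equivalently, of trigraded modules over the exterior algebra $\Lambda_3$ on $\partial_1,\partial_2,\partial_3$. Its stable category $\mathcal{SM}_3$ has the same objects, and its morphisms are those of $\mathcal M_3$ modulo the morphisms which factor through a projective object. The shift $M[1]_{\mathcal{SM}}$ is the cokernel of the canonical embedding $\iota_M\colon M\to I(M):=\operatorname{Hom}_\Bbbk(\Lambda_3,M)\cong\Lambda_3\otimes M\{-1,-1,-1\}$, and the distinguished triangles are those isomorphic to $M\xrightarrow{f}N\to C\to M[1]_{\mathcal{SM}}$, where $f$ is a morphism of $\mathcal M_3$, $C$ is the pushout of $f$ and $\iota_M$, and $C\to M[1]_{\mathcal{SM}}$ is induced by $0$ on $N$ and by the projection on $I(M)$. For a complex $M$ of graded $A$-modules let $\mathcal G_\infty(M)\in\mathcal M_3$ be given by $\mathcal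 G_\infty(M)_{i,j,k}=(i-j)M_k^j$ with, writing $r=i-j$, $\partial_1$ the action of $(r|r+1)$, $\partial_2$ the action of $(r|r-1)$ multiplied by $(-1)^r$, and $\partial_3=(-1)^{r+k}d$. Then $\mathcal G_\infty$ is an equivalence from the category of graded dg modules over $(A,d)$ to $\mathcal M_3$, and it descends to an exact functor $$\mathcal G\colon \mathcal C(A\text{-pmod})\longrightarrow\mathcal{SM}_3 .$$ That is, there is an additive functor $\mathcal G$ whose composition with the projection from the category of complexes of graded projective $A$-modules to $\mathcal C(A\text{-pmod})$ equals the restriction of $\mathcal G_\infty$ followed by the projection $\mathcal M_3\to\mathcal{SM}_3$, together with a natural isomorphism $\mathcal G(M[1])\cong\mathcal G(M)[1]_{\mathcal{SM}}$ under which $\mathcal G$ takes distinguished triangles to distinguished triangles. -/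

import Mathlib

open CategoryTheory CategoryTheory.Limits

universe u

/-! ### The zig-zag algebra -/

/-- The paths of length at most one in the quiver with vertex set `ℤ` and arrows `r → r + 1` and
`r → r - 1`: `e r` is the trivial path `(r)`, `a r` is `(r|r+1)` and `b r` is `(r|r-1)`. -/
inductive ZigzagGen : Type
  | e (r : ℤ)
  | a (r : ℤ)
  | b (r : ℤ)

open ZigzagGen FreeAlgebra in
/-- The defining relations of the zig-zag algebra. Products of paths are concatenations:
`(i|j)·(j|k) = (i|j|k)`. -/
inductive ZigzagRel (𝕜 : Type u) [Field 𝕜] :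
    FreeAlgebra 𝕜 ZigzagGen → FreeAlgebra 𝕜 ZigzagGen → Prop
  | idem (r : ℤ) : ZigzagRel 𝕜 (ι 𝕜 (e r) * ι 𝕜 (e r)) (ι 𝕜 (e r))
  | orth (r s : ℤ) (h : r ≠ s) : ZigzagRel 𝕜 (ι 𝕜 (e r) * ι 𝕜 (e s)) 0
  | a_start (r : ℤ) : ZigzagRel 𝕜 (ι 𝕜 (e r) * ι 𝕜 (a r)) (ι 𝕜 (a r))
  | a_end (r : ℤ) : ZigzagRel 𝕜 (ι 𝕜 (a r) * ι 𝕜 (e (r + 1))) (ι 𝕜 (a r))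
  | b_start (r : ℤ) : ZigzagRel 𝕜 (ι 𝕜 (e r) * ι 𝕜 (b r)) (ι 𝕜 (b r))
  | b_end (r : ℤ) : ZigzagRel 𝕜 (ι 𝕜 (b r) * ι 𝕜 (e (r - 1))) (ι 𝕜 (b r))
  | a_a (r : ℤ) : ZigzagRel 𝕜 (ι 𝕜 (a r) * ι 𝕜 (a (r + 1))) 0
  | b_b (r : ℤ) : ZigzagRel 𝕜 (ι 𝕜 (b r) * ι 𝕜 (b (r - 1))) 0
  | loop (r : ℤ) : ZigzagRel 𝕜 (ι 𝕜 (b r) * ι 𝕜 (a (r - 1))) (ι 𝕜 (a r) * ι 𝕜 (b (r + 1)))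

/-- The zig-zag algebra `A = A_∞`, a non-unital algebra. It is the quotient of the path algebra of
the above quiver by the relations `(r|r+1|r+2) = 0`, `(r|r-1|r-2) = 0` and `(r|r-1|r) = (r|r+1|r)`,
realized as the non-unital subalgebra generated by the paths of length at most one inside its
unitization (the unital algebra with the same presentation). -/
def ZigzagAlg (𝕜 : Type u) [Field 𝕜] : NonUnitalSubalgebra 𝕜 (RingQuot (ZigzagRel 𝕜)) :=
  NonUnitalAlgebra.adjoin 𝕜
    (Set.range fun g => RingQuot.mkAlgHom 𝕜 (ZigzagRel 𝕜) (FreeAlgebra.ι 𝕜 g))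

namespace ZigzagAlg

variable (𝕜 : Type u) [Field 𝕜]

/-- The class in `A` of a path of length at most one. -/
def of (g : ZigzagGen) : ZigzagAlg 𝕜 :=
  ⟨RingQuot.mkAlgHom 𝕜 (ZigzagRel 𝕜) (FreeAlgebra.ι 𝕜 g),
    NonUnitalAlgebra.subset_adjoin 𝕜 ⟨g, rfl⟩⟩

/-- The idempotent `(r)`. -/
def e (r : ℤ) : ZigzagAlg 𝕜 := of 𝕜 (.e r)

/-- The path `(r|r+1)`. -/
def a (r : ℤ) : ZigzagAlg 𝕜 := of 𝕜 (.a r)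

/-- The path `(r|r-1)`. -/
def b (r : ℤ) : ZigzagAlg 𝕜 := of 𝕜 (.b r)

variable {𝕜}

theorem e_mul_e (r : ℤ) : e 𝕜 r * e 𝕜 r = e 𝕜 r :=
  Subtype.ext (((map_mul _ _ _).symm.trans (RingQuot.mkAlgHom_rel 𝕜 (.idem r))))

theorem a_mul_e (r : ℤ) : a 𝕜 r * e 𝕜 (r + 1) = a 𝕜 r :=
  Subtype.ext (((map_mul _ _ _).symm.trans (RingQuot.mkAlgHom_rel 𝕜 (.a_end r))))

theorem b_mul_e (r : ℤ) : b 𝕜 r * e 𝕜 (r - 1) = b 𝕜 r :=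
  Subtype.ext (((map_mul _ _ _).symm.trans (RingQuot.mkAlgHom_rel 𝕜 (.b_end r))))

theorem a_mul_a (r : ℤ) : a 𝕜 r * a 𝕜 (r + 1) = 0 :=
  Subtype.ext (((map_mul _ _ _).symm.trans
    ((RingQuot.mkAlgHom_rel 𝕜 (.a_a r)).trans (map_zero _))))

theorem b_mul_b (r : ℤ) : b 𝕜 r * b 𝕜 (r - 1) = 0 :=
  Subtype.ext (((map_mul _ _ _).symm.trans
    ((RingQuot.mkAlgHom_rel 𝕜 (.b_b r)).trans (map_zero _))))

theorem b_mul_a (r : ℤ) : b 𝕜 r * a 𝕜 (r - 1) = a 𝕜 r * b 𝕜 (r + 1) :=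
  Subtype.ext (((map_mul _ _ _).symm.trans
    ((RingQuot.mkAlgHom_rel 𝕜 (.loop r)).trans (map_mul _ _ _))))

/-- The grading of `A` determined by `deg (r) = deg (r|r+1) = 0` and `deg (r|r-1) = 1`:
`HasDegree x d` says that `x` is homogeneous of degree `d`. -/
inductive HasDegree : ZigzagAlg 𝕜 → ℤ → Prop
  | e (r : ℤ) : HasDegree (e 𝕜 r) 0
  | a (r : ℤ) : HasDegree (a 𝕜 r) 0
  | b (r : ℤ) : HasDegree (b 𝕜 r) 1
  | mul {x y : ZigzagAlg 𝕜} {d d' : ℤ} : HasDegree x d → HasDegree y d' → HasDegree (x * y) (d + d')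
  | zero (d : ℤ) : HasDegree 0 d
  | add {x y : ZigzagAlg 𝕜} {d : ℤ} : HasDegree x d → HasDegree y d → HasDegree (x + y) d
  | smul (c : 𝕜) {x : ZigzagAlg 𝕜} {d : ℤ} : HasDegree x d → HasDegree (c • x) d

end ZigzagAlg

/-! ### Graded modules over the zig-zag algebra -/

/-- A graded `A`-module: a `𝕜`-vector space with an action of the non-unital algebra `A` and a grading
`M = ⨁ⱼ Mʲ`, such that elements of degree `d` raise the degree by `d` and `M = ⨁ᵣ (r)M`. A product
`x * y` of paths acts as `x` followed by `y`, so that a path from the vertex `r` to the vertex `s`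
acts as a map `(r)M ⟶ (s)M`. -/
structure GrMod (𝕜 : Type u) [Field 𝕜] where
  carrier : Type u
  [grp : AddCommGroup carrier]
  [mod : Module 𝕜 carrier]
  act : ZigzagAlg 𝕜 →ₗ[𝕜] Module.End 𝕜 carrier
  act_mul : ∀ x y m, act (x * y) m = act y (act x m)
  gr : ℤ → Submodule 𝕜 carrier
  isInternal : DirectSum.IsInternal gr
  act_mem : ∀ {x : ZigzagAlg 𝕜} {d : ℤ}, ZigzagAlg.HasDegree x d →
    ∀ {j : ℤ} {m : carrier}, m ∈ gr j → act x m ∈ gr (j + d)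
  iSup_range : ⨆ r, LinearMap.range (act (ZigzagAlg.e 𝕜 r)) = ⊤

namespace GrMod

attribute [instance] GrMod.grp GrMod.mod

variable {𝕜 : Type u} [Field 𝕜]

/-- Morphisms of graded `A`-modules: `A`-linear maps which preserve the grading. -/
@[ext]
structure Hom (M N : GrMod 𝕜) where
  lin : M.carrier →ₗ[𝕜] N.carrier
  map_act : ∀ x m, lin (M.act x m) = N.act x (lin m)
  map_gr : ∀ {j m}, m ∈ M.gr j → lin m ∈ N.gr j

/-- The category of graded `A`-modules. -/
instance : Category (GrMod 𝕜) where
  Hom := Hom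
  id M := ⟨LinearMap.id, fun _ _ => rfl, id⟩
  comp f g := ⟨g.lin ∘ₗ f.lin, fun x m => by simp [f.map_act, g.map_act],
    fun h => g.map_gr (f.map_gr h)⟩

@[ext]
theorem hom_ext {M N : GrMod 𝕜} {f g : M ⟶ N} (h : ∀ x, f.lin x = g.lin x) : f = g :=
  Hom.ext (LinearMap.ext h)

@[simp] theorem id_lin (M : GrMod 𝕜) (x : M.carrier) : Hom.lin (𝟙 M) x = x := rfl

@[simp] theorem comp_lin {M N P : GrMod 𝕜} (f : M ⟶ N) (g : N ⟶ P) (x : M.carrier) :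
    (f ≫ g).lin x = g.lin (f.lin x) := rfl

instance (M N : GrMod 𝕜) : Zero (M ⟶ N) :=
  ⟨⟨0, fun _ _ => by simp, fun _ => by simp⟩⟩

instance (M N : GrMod 𝕜) : Add (M ⟶ N) :=
  ⟨fun f g => ⟨f.lin + g.lin, fun _ _ => by simp [f.map_act, g.map_act],
    fun h => add_mem (f.map_gr h) (g.map_gr h)⟩⟩

instance (M N : GrMod 𝕜) : Neg (M ⟶ N) :=
  ⟨fun f => ⟨-f.lin, fun _ _ => by simp [f.map_act], fun h => neg_mem (f.map_gr h)⟩⟩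

@[simp] theorem zero_lin {M N : GrMod 𝕜} (x : M.carrier) : (0 : M ⟶ N).lin x = 0 := rfl

@[simp] theorem add_lin {M N : GrMod 𝕜} (f g : M ⟶ N) (x : M.carrier) :
    (f + g).lin x = f.lin x + g.lin x := rfl

@[simp] theorem neg_lin {M N : GrMod 𝕜} (f : M ⟶ N) (x : M.carrier) :
    (-f).lin x = -f.lin x := rfl

instance (M N : GrMod 𝕜) : AddCommGroup (M ⟶ N) where
  add_assoc f g h := by ext; simp [add_assoc]
  zero_add f := by ext; simp
  add_zero f := by ext; simp
  add_comm f g := by ext; simp [add_comm]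
  neg_add_cancel f := by ext; simp
  nsmul := nsmulRec
  zsmul := zsmulRec

instance : Preadditive (GrMod 𝕜) where
  add_comp _ _ _ f g h := by ext; simp
  comp_add _ _ _ f g h := by ext; simp

/-- The zero module. -/
def zeroObj (𝕜 : Type u) [Field 𝕜] : GrMod 𝕜 where
  carrier := PUnit.{u + 1}
  act := 0
  act_mul _ _ _ := rfl
  gr _ := ⊤
  isInternal := (DirectSum.isInternal_submodule_iff_iSupIndep_and_iSup_eq_top _).2
    ⟨fun _ => Submodule.disjoint_def.2 fun _ _ _ => rfl, Subsingleton.elim _ _⟩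
  act_mem _ _ _ _ := trivial
  iSup_range := Subsingleton.elim _ _

theorem isZero_zeroObj : IsZero (zeroObj 𝕜) := by
  rw [IsZero.iff_id_eq_zero]
  ext x
  rfl

instance : HasZeroObject (GrMod 𝕜) := ⟨zeroObj 𝕜, isZero_zeroObj⟩

theorem iSup_prod_eq_top {V W : Type u} [AddCommGroup V] [Module 𝕜 V] [AddCommGroup W] [Module 𝕜 W]
    {p : ℤ → Submodule 𝕜 V} {q : ℤ → Submodule 𝕜 W} (hp : ⨆ i, p i = ⊤) (hq : ⨆ i, q i = ⊤) :
    ⨆ i, (p i).prod (q i) = ⊤ := by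
  rw [eq_top_iff, ← Submodule.prod_top, ← hp, ← hq, LinearMap.prod_eq_sup_map, Submodule.map_iSup,
    Submodule.map_iSup]
  refine sup_le (iSup_mono fun i => ?_) (iSup_mono fun i => ?_)
  · rintro _ ⟨x, hx, rfl⟩
    exact ⟨hx, zero_mem _⟩
  · rintro _ ⟨x, hx, rfl⟩
    exact ⟨zero_mem _, hx⟩

/-- The direct sum of two graded modules. -/
def prod (M N : GrMod 𝕜) : GrMod 𝕜 where
  carrier := M.carrier × N.carrier
  act :=
    { toFun := fun x => (M.act x).prodMap (N.act x)
      map_add' := fun x y => by ext <;> simp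
      map_smul' := fun c x => by ext <;> simp }
  act_mul x y m := by ext <;> simp [M.act_mul, N.act_mul]
  gr j := (M.gr j).prod (N.gr j)
  isInternal := by
    rw [DirectSum.isInternal_submodule_iff_iSupIndep_and_iSup_eq_top]
    have hM := (DirectSum.isInternal_submodule_iff_iSupIndep_and_iSup_eq_top _).1 M.isInternal
    have hN := (DirectSum.isInternal_submodule_iff_iSupIndep_and_iSup_eq_top _).1 N.isInternal
    constructor
    · intro j
      rw [Submodule.disjoint_def]
      intro x hx hx'
      have h1 : ⨆ i, ⨆ (_ : i ≠ j), (M.gr i).prod (N.gr i) ≤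
          (⨆ i, ⨆ (_ : i ≠ j), M.gr i).prod (⨆ i, ⨆ (_ : i ≠ j), N.gr i) :=
        iSup₂_le fun i hi => Submodule.prod_mono
          (le_iSup₂_of_le (f := fun i (_ : i ≠ j) => M.gr i) i hi le_rfl)
          (le_iSup₂_of_le (f := fun i (_ : i ≠ j) => N.gr i) i hi le_rfl)
      have h2 := h1 hx'
      exact Prod.ext ((Submodule.disjoint_def.1 (hM.1 j)) _ hx.1 h2.1)
        ((Submodule.disjoint_def.1 (hN.1 j)) _ hx.2 h2.2)
    · exact iSup_prod_eq_top hM.2 hN.2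
  act_mem h _ _ hm := ⟨M.act_mem h hm.1, N.act_mem h hm.2⟩
  iSup_range := by
    refine Eq.trans (iSup_congr fun r => ?_) (iSup_prod_eq_top M.iSup_range N.iSup_range)
    ext ⟨m, n⟩
    constructor
    · rintro ⟨⟨x, y⟩, h⟩
      exact ⟨⟨x, congrArg Prod.fst h⟩, ⟨y, congrArg Prod.snd h⟩⟩
    · rintro ⟨⟨x, hx⟩, ⟨y, hy⟩⟩
      exact ⟨(x, y), Prod.ext hx hy⟩

instance : HasBinaryBiproducts (GrMod 𝕜) where
  has_binary_biproduct M N := HasBinaryBiproduct.mk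
    { bicone :=
        { pt := prod M N
          fst := ⟨LinearMap.fst _ _ _, fun _ _ => rfl, fun h => h.1⟩
          snd := ⟨LinearMap.snd _ _ _, fun _ _ => rfl, fun h => h.2⟩
          inl := ⟨LinearMap.inl _ _ _, fun _ _ => Prod.ext rfl (map_zero (N.act _)).symm,
            fun h => ⟨h, zero_mem _⟩⟩
          inr := ⟨LinearMap.inr _ _ _, fun _ _ => Prod.ext (map_zero (M.act _)).symm rfl,
            fun h => ⟨zero_mem _, h⟩⟩
          inl_fst := rfl
          inl_snd := rfl
          inr_fst := rfl
          inr_snd := rfl }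
      isBilimit := isBinaryBilimitOfTotal _ (by
        ext x
        exact Prod.ext (add_zero _) (zero_add _)) }

variable (𝕜)

/-- The category `A-pmod` of graded projective `A`-modules. -/
abbrev Proj : Type (u + 1) := (isProjective (GrMod 𝕜)).FullSubcategory

instance : (isProjective (GrMod 𝕜)).ContainsZero :=
  ⟨zeroObj 𝕜, isZero_zeroObj, isZero_zeroObj.projective⟩

instance : HasBinaryBiproducts (Proj 𝕜) where
  has_binary_biproduct M N := by
    have := M.property
    have := N.property
    have h : Projective (M.obj ⊞ N.obj) :=
      ⟨fun {E X} f e _ => ⟨biprod.desc (Projective.factorThru (biprod.inl ≫ f) e)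
        (Projective.factorThru (biprod.inr ≫ f) e), by
          apply biprod.hom_ext' <;> simp⟩⟩
    exact HasBinaryBiproduct.mk
      { bicone :=
          { pt := ⟨M.obj ⊞ N.obj, h⟩
            fst := ⟨biprod.fst⟩
            snd := ⟨biprod.snd⟩
            inl := ⟨biprod.inl⟩
            inr := ⟨biprod.inr⟩
            inl_fst := by ext1; exact biprod.inl_fst
            inl_snd := by ext1; exact biprod.inl_snd
            inr_fst := by ext1; exact biprod.inr_fst
            inr_snd := by ext1; exact biprod.inr_snd }
        isBilimit := isBinaryBilimitOfTotal _ (by ext1; exact biprod.total) }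


end GrMod

/-! ### Trigraded modules over the exterior algebra on three generators -/

/-- A trigraded module over the exterior algebra `Λ₃` over `𝕜` on `∂₁, ∂₂, ∂₃` of degrees
`(1,0,0)`, `(0,1,0)`, `(0,0,1)`: vector spaces `X i j k`, `i j k : ℤ`, and linear maps
`∂ᵣ` of degree `eᵣ` subject to `∂ᵣ² = 0` and `∂ᵣ ∂ₛ + ∂ₛ ∂ᵣ = 0`. The target
degree of each `∂ᵣ` is allowed to be any integer that is provably the right one. -/
structure TriMod (𝕜 : Type u) [Field 𝕜] where
  X : ℤ → ℤ → ℤ → Type u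
  [grp : ∀ i j k, AddCommGroup (X i j k)]
  [mod : ∀ i j k, Module 𝕜 (X i j k)]
  d1 : ∀ {i i' : ℤ} (j k : ℤ), i + 1 = i' → X i j k →ₗ[𝕜] X i' j k
  d2 : ∀ (i : ℤ) {j j' : ℤ} (k : ℤ), j + 1 = j' → X i j k →ₗ[𝕜] X i j' k
  d3 : ∀ (i j : ℤ) {k k' : ℤ}, k + 1 = k' → X i j k →ₗ[𝕜] X i j k'
  d1_d1 : ∀ {i i' i'' : ℤ} (j k : ℤ) (h : i + 1 = i') (h' : i' + 1 = i'') (x : X i j k),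
    d1 j k h' (d1 j k h x) = 0
  d2_d2 : ∀ (i : ℤ) {j j' j'' : ℤ} (k : ℤ) (h : j + 1 = j') (h' : j' + 1 = j'') (x : X i j k),
    d2 i k h' (d2 i k h x) = 0
  d3_d3 : ∀ (i j : ℤ) {k k' k'' : ℤ} (h : k + 1 = k') (h' : k' + 1 = k'') (x : X i j k),
    d3 i j h' (d3 i j h x) = 0
  d1_d2 : ∀ {i i' j j' : ℤ} (k : ℤ) (h : i + 1 = i') (h' : j + 1 = j') (x : X i j k),
    d1 j' k h (d2 i k h' x) + d2 i' k h' (d1 j k h x) = 0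
  d1_d3 : ∀ {i i' : ℤ} (j : ℤ) {k k' : ℤ} (h : i + 1 = i') (h' : k + 1 = k') (x : X i j k),
    d1 j k' h (d3 i j h' x) + d3 i' j h' (d1 j k h x) = 0
  d2_d3 : ∀ (i : ℤ) {j j' k k' : ℤ} (h : j + 1 = j') (h' : k + 1 = k') (x : X i j k),
    d2 i k' h (d3 i j h' x) + d3 i j' h' (d2 i k h x) = 0

namespace TriMod

attribute [instance] TriMod.grp TriMod.mod

variable {𝕜 : Type u} [Field 𝕜]

/-- Morphisms of trigraded `Λ₃`-modules: degree-preserving linear maps commuting with all `∂ᵣ`. -/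
@[ext]
structure Hom (M N : TriMod 𝕜) where
  app : ∀ i j k, M.X i j k →ₗ[𝕜] N.X i j k
  comm1 : ∀ {i i' : ℤ} (j k : ℤ) (h : i + 1 = i') (x : M.X i j k),
    app i' j k (M.d1 j k h x) = N.d1 j k h (app i j k x)
  comm2 : ∀ (i : ℤ) {j j' : ℤ} (k : ℤ) (h : j + 1 = j') (x : M.X i j k),
    app i j' k (M.d2 i k h x) = N.d2 i k h (app i j k x)
  comm3 : ∀ (i j : ℤ) {k k' : ℤ} (h : k + 1 = k') (x : M.X i j k),
    app i j k' (M.d3 i j h x) = N.d3 i j h (app i j k x)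

/-- The category `𝓜₃` of trigraded `Λ₃`-modules. -/
instance : Category (TriMod 𝕜) where
  Hom := Hom
  id M := ⟨fun _ _ _ => LinearMap.id, fun _ _ _ _ => rfl, fun _ _ _ _ _ _ => rfl,
    fun _ _ _ _ _ _ => rfl⟩
  comp f g := ⟨fun i j k => g.app i j k ∘ₗ f.app i j k,
    fun j k h x => by simp [f.comm1, g.comm1],
    fun i _ _ k h x => by simp [f.comm2, g.comm2],
    fun i j _ _ h x => by simp [f.comm3, g.comm3]⟩

@[ext]
theorem hom_ext {M N : TriMod 𝕜} {f g : M ⟶ N}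
    (h : ∀ i j k x, f.app i j k x = g.app i j k x) : f = g :=
  Hom.ext (by funext i j k; exact LinearMap.ext (h i j k))

@[simp] theorem id_app (M : TriMod 𝕜) (i j k : ℤ) (x : M.X i j k) :
    Hom.app (𝟙 M) i j k x = x := rfl

@[simp] theorem comp_app {M N P : TriMod 𝕜} (f : M ⟶ N) (g : N ⟶ P) (i j k : ℤ) (x : M.X i j k) :
    (f ≫ g).app i j k x = g.app i j k (f.app i j k x) := rfl

instance (M N : TriMod 𝕜) : Zero (M ⟶ N) :=
  ⟨⟨fun _ _ _ => 0, fun _ _ _ _ => by simp, fun _ _ _ _ _ _ => by simp,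
    fun _ _ _ _ _ _ => by simp⟩⟩

instance (M N : TriMod 𝕜) : Add (M ⟶ N) :=
  ⟨fun f g => ⟨fun i j k => f.app i j k + g.app i j k,
    fun _ _ _ _ => by simp [f.comm1, g.comm1], fun _ _ _ _ _ _ => by simp [f.comm2, g.comm2],
    fun _ _ _ _ _ _ => by simp [f.comm3, g.comm3]⟩⟩

instance (M N : TriMod 𝕜) : Neg (M ⟶ N) :=
  ⟨fun f => ⟨fun i j k => -f.app i j k,
    fun _ _ _ _ => by simp [f.comm1], fun _ _ _ _ _ _ => by simp [f.comm2],
    fun _ _ _ _ _ _ => by simp [f.comm3]⟩⟩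

@[simp] theorem zero_app {M N : TriMod 𝕜} (i j k : ℤ) (x : M.X i j k) :
    (0 : M ⟶ N).app i j k x = 0 := rfl

@[simp] theorem add_app {M N : TriMod 𝕜} (f g : M ⟶ N) (i j k : ℤ) (x : M.X i j k) :
    (f + g).app i j k x = f.app i j k x + g.app i j k x := rfl

@[simp] theorem neg_app {M N : TriMod 𝕜} (f : M ⟶ N) (i j k : ℤ) (x : M.X i j k) :
    (-f).app i j k x = -f.app i j k x := rfl

instance (M N : TriMod 𝕜) : AddCommGroup (M ⟶ N) where
  add_assoc f g h := by ext; simp [add_assoc]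
  zero_add f := by ext; simp
  add_zero f := by ext; simp
  add_comm f g := by ext; simp [add_comm]
  neg_add_cancel f := by ext; simp
  nsmul := nsmulRec
  zsmul := zsmulRec

@[simp] theorem sub_app {M N : TriMod 𝕜} (f g : M ⟶ N) (i j k : ℤ) (x : M.X i j k) :
    (f - g).app i j k x = f.app i j k x - g.app i j k x := by
  rw [sub_eq_add_neg, sub_eq_add_neg]; rfl

instance : Preadditive (TriMod 𝕜) where
  add_comp _ _ _ f g h := by ext; simp
  comp_add _ _ _ f g h := by ext; simp

/-- The cokernel of a morphism `f` of trigraded `Λ₃`-modules, computed degreewise. -/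
def coker {M N : TriMod 𝕜} (f : M ⟶ N) : TriMod 𝕜 where
  X i j k := N.X i j k ⧸ LinearMap.range (f.app i j k)
  d1 {i i'} j k h := Submodule.mapQ _ _ (N.d1 j k h) (by
    rintro _ ⟨x, rfl⟩; exact ⟨M.d1 j k h x, f.comm1 j k h x⟩)
  d2 i {j j'} k h := Submodule.mapQ _ _ (N.d2 i k h) (by
    rintro _ ⟨x, rfl⟩; exact ⟨M.d2 i k h x, f.comm2 i k h x⟩)
  d3 i j {k k'} h := Submodule.mapQ _ _ (N.d3 i j h) (by
    rintro _ ⟨x, rfl⟩; exact ⟨M.d3 i j h x, f.comm3 i j h x⟩)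
  d1_d1 j k h h' x := by
    induction x using Submodule.Quotient.induction_on with
    | _ x => simp [N.d1_d1]
  d2_d2 i _ _ _ k h h' x := by
    induction x using Submodule.Quotient.induction_on with
    | _ x => simp [N.d2_d2]
  d3_d3 i j _ _ _ h h' x := by
    induction x using Submodule.Quotient.induction_on with
    | _ x => simp [N.d3_d3]
  d1_d2 k h h' x := by
    induction x using Submodule.Quotient.induction_on with
    | _ x => simp [← Submodule.Quotient.mk_add, N.d1_d2]
  d1_d3 j _ _ h h' x := by
    induction x using Submodule.Quotient.induction_on with
    | _ x => simp [← Submodule.Quotient.mk_add, N.d1_d3]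
  d2_d3 i _ _ _ _ h h' x := by
    induction x using Submodule.Quotient.induction_on with
    | _ x => simp [← Submodule.Quotient.mk_add, N.d2_d3]

/-- The projection onto the cokernel. -/
def cokerπ {M N : TriMod 𝕜} (f : M ⟶ N) : N ⟶ coker f where
  app _ _ _ := Submodule.mkQ _
  comm1 _ _ _ _ := rfl
  comm2 _ _ _ _ _ _ := rfl
  comm3 _ _ _ _ _ _ := rfl

theorem comp_cokerπ {M N : TriMod 𝕜} (f : M ⟶ N) : f ≫ cokerπ f = 0 := by
  ext i j k x
  exact (Submodule.Quotient.mk_eq_zero _).2 ⟨x, rfl⟩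

/-- The universal property of the cokernel. -/
def cokerDesc {M N P : TriMod 𝕜} (f : M ⟶ N) (g : N ⟶ P) (hg : f ≫ g = 0) : coker f ⟶ P where
  app i j k := Submodule.liftQ _ (g.app i j k) (by
    rintro _ ⟨x, rfl⟩
    exact congrArg (fun t : M ⟶ P => t.app i j k x) hg)
  comm1 j k h x := by
    induction x using Submodule.Quotient.induction_on with
    | _ x => exact g.comm1 j k h x
  comm2 i _ _ k h x := by
    induction x using Submodule.Quotient.induction_on with
    | _ x => exact g.comm2 i k h x
  comm3 i j _ _ h x := by
    induction x using Submodule.Quotient.induction_on with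
    | _ x => exact g.comm3 i j h x

theorem cokerπ_desc {M N P : TriMod 𝕜} (f : M ⟶ N) (g : N ⟶ P) (hg : f ≫ g = 0) :
    cokerπ f ≫ cokerDesc f g hg = g := rfl

theorem epi_of_surjective {M N : TriMod 𝕜} (f : M ⟶ N)
    (hf : ∀ i j k, Function.Surjective (f.app i j k)) : Epi f where
  left_cancellation g h e := by
    ext i j k y
    obtain ⟨x, rfl⟩ := hf i j k y
    exact congrArg (fun t : M ⟶ _ => t.app i j k x) e

instance {M N : TriMod 𝕜} (f : M ⟶ N) : Epi (cokerπ f) :=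
  epi_of_surjective _ fun _ _ _ => Submodule.mkQ_surjective _

theorem surjective_of_epi {M N : TriMod 𝕜} (f : M ⟶ N) [Epi f] (i j k : ℤ) :
    Function.Surjective (f.app i j k) := by
  have h : cokerπ f = 0 := by
    rw [← cancel_epi f, comp_cokerπ, comp_zero]
  intro y
  exact (Submodule.Quotient.mk_eq_zero _).1 (congrArg (fun t : N ⟶ _ => t.app i j k y) h)

section Cofree

variable (V : ℤ → ℤ → ℤ → Type u) [∀ i j k, AddCommGroup (V i j k)] [∀ i j k, Module 𝕜 (V i j k)]

/-- The degree `(i,j,k)` part of `Hom_𝕜(Λ₃, V)`: an element `f` is recorded by its values at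
`1, ∂₁, ∂₂, ∂₃, ∂₁∂₂, ∂₁∂₃, ∂₂∂₃, ∂₁∂₂∂₃`, in this order. -/
@[ext]
structure CofreeX (V : ℤ → ℤ → ℤ → Type u) (i j k : ℤ) : Type u where
  e : V i j k
  a1 : V (i + 1) j k
  a2 : V i (j + 1) k
  a3 : V i j (k + 1)
  a12 : V (i + 1) (j + 1) k
  a13 : V (i + 1) j (k + 1)
  a23 : V i (j + 1) (k + 1)
  a123 : V (i + 1) (j + 1) (k + 1)

namespace CofreeX

variable {V} {i j k : ℤ}

instance : Zero (CofreeX V i j k) := ⟨⟨0, 0, 0, 0, 0, 0, 0, 0⟩⟩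

instance : Add (CofreeX V i j k) :=
  ⟨fun x y => ⟨x.e + y.e, x.a1 + y.a1, x.a2 + y.a2, x.a3 + y.a3,
    x.a12 + y.a12, x.a13 + y.a13, x.a23 + y.a23, x.a123 + y.a123⟩⟩

instance : Neg (CofreeX V i j k) :=
  ⟨fun x => ⟨-x.e, -x.a1, -x.a2, -x.a3, -x.a12, -x.a13, -x.a23, -x.a123⟩⟩

instance : SMul 𝕜 (CofreeX V i j k) :=
  ⟨fun c x => ⟨c • x.e, c • x.a1, c • x.a2, c • x.a3, c • x.a12,
    c • x.a13, c • x.a23, c • x.a123⟩⟩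

@[simp] theorem zero_e : (0 : CofreeX V i j k).e = 0 := rfl
@[simp] theorem add_e (x y : CofreeX V i j k) : (x + y).e = x.e + y.e := rfl
@[simp] theorem neg_e (x : CofreeX V i j k) : (-x).e = -x.e := rfl
@[simp] theorem smul_e (c : 𝕜) (x : CofreeX V i j k) : (c • x).e = c • x.e := rfl
@[simp] theorem zero_a1 : (0 : CofreeX V i j k).a1 = 0 := rfl
@[simp] theorem add_a1 (x y : CofreeX V i j k) : (x + y).a1 = x.a1 + y.a1 := rfl
@[simp] theorem neg_a1 (x : CofreeX V i j k) : (-x).a1 = -x.a1 := rfl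
@[simp] theorem smul_a1 (c : 𝕜) (x : CofreeX V i j k) : (c • x).a1 = c • x.a1 := rfl
@[simp] theorem zero_a2 : (0 : CofreeX V i j k).a2 = 0 := rfl
@[simp] theorem add_a2 (x y : CofreeX V i j k) : (x + y).a2 = x.a2 + y.a2 := rfl
@[simp] theorem neg_a2 (x : CofreeX V i j k) : (-x).a2 = -x.a2 := rfl
@[simp] theorem smul_a2 (c : 𝕜) (x : CofreeX V i j k) : (c • x).a2 = c • x.a2 := rfl
@[simp] theorem zero_a3 : (0 : CofreeX V i j k).a3 = 0 := rfl
@[simp] theorem add_a3 (x y : CofreeX V i j k) : (x + y).a3 = x.a3 + y.a3 := rfl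
@[simp] theorem neg_a3 (x : CofreeX V i j k) : (-x).a3 = -x.a3 := rfl
@[simp] theorem smul_a3 (c : 𝕜) (x : CofreeX V i j k) : (c • x).a3 = c • x.a3 := rfl
@[simp] theorem zero_a12 : (0 : CofreeX V i j k).a12 = 0 := rfl
@[simp] theorem add_a12 (x y : CofreeX V i j k) : (x + y).a12 = x.a12 + y.a12 := rfl
@[simp] theorem neg_a12 (x : CofreeX V i j k) : (-x).a12 = -x.a12 := rfl
@[simp] theorem smul_a12 (c : 𝕜) (x : CofreeX V i j k) : (c • x).a12 = c • x.a12 := rfl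
@[simp] theorem zero_a13 : (0 : CofreeX V i j k).a13 = 0 := rfl
@[simp] theorem add_a13 (x y : CofreeX V i j k) : (x + y).a13 = x.a13 + y.a13 := rfl
@[simp] theorem neg_a13 (x : CofreeX V i j k) : (-x).a13 = -x.a13 := rfl
@[simp] theorem smul_a13 (c : 𝕜) (x : CofreeX V i j k) : (c • x).a13 = c • x.a13 := rfl
@[simp] theorem zero_a23 : (0 : CofreeX V i j k).a23 = 0 := rfl
@[simp] theorem add_a23 (x y : CofreeX V i j k) : (x + y).a23 = x.a23 + y.a23 := rfl
@[simp] theorem neg_a23 (x : CofreeX V i j k) : (-x).a23 = -x.a23 := rfl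
@[simp] theorem smul_a23 (c : 𝕜) (x : CofreeX V i j k) : (c • x).a23 = c • x.a23 := rfl
@[simp] theorem zero_a123 : (0 : CofreeX V i j k).a123 = 0 := rfl
@[simp] theorem add_a123 (x y : CofreeX V i j k) : (x + y).a123 = x.a123 + y.a123 := rfl
@[simp] theorem neg_a123 (x : CofreeX V i j k) : (-x).a123 = -x.a123 := rfl
@[simp] theorem smul_a123 (c : 𝕜) (x : CofreeX V i j k) : (c • x).a123 = c • x.a123 := rfl

instance : AddCommGroup (CofreeX V i j k) where
  add_assoc x y z := by ext <;> simp [add_assoc]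
  zero_add x := by ext <;> simp
  add_zero x := by ext <;> simp
  add_comm x y := by ext <;> simp [add_comm]
  neg_add_cancel x := by ext <;> simp
  nsmul := nsmulRec
  zsmul := zsmulRec

instance : Module 𝕜 (CofreeX V i j k) where
  one_smul x := by ext <;> simp
  mul_smul c d x := by ext <;> simp [mul_smul]
  smul_zero c := by ext <;> simp
  smul_add c x y := by ext <;> simp
  add_smul c d x := by ext <;> simp [add_smul]
  zero_smul x := by ext <;> simp

end CofreeX

/-- The action of `∂₁` on `Hom_𝕜(Λ₃, V)`. -/
@[simps] def cofree1 (i j k : ℤ) : CofreeX V i j k →ₗ[𝕜] CofreeX V (i + 1) j k where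
  toFun x := ⟨x.a1, 0, -x.a12, -x.a13, 0, 0, x.a123, 0⟩
  map_add' x y := by ext <;> simp [add_comm]
  map_smul' c x := by ext <;> simp

/-- The action of `∂₂` on `Hom_𝕜(Λ₃, V)`. -/
@[simps] def cofree2 (i j k : ℤ) : CofreeX V i j k →ₗ[𝕜] CofreeX V i (j + 1) k where
  toFun x := ⟨x.a2, x.a12, 0, -x.a23, 0, -x.a123, 0, 0⟩
  map_add' x y := by ext <;> simp [add_comm]
  map_smul' c x := by ext <;> simp

/-- The action of `∂₃` on `Hom_𝕜(Λ₃, V)`. -/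
@[simps] def cofree3 (i j k : ℤ) : CofreeX V i j k →ₗ[𝕜] CofreeX V i j (k + 1) where
  toFun x := ⟨x.a3, x.a13, x.a23, 0, x.a123, 0, 0, 0⟩
  map_add' x y := by ext <;> simp
  map_smul' c x := by ext <;> simp

variable (𝕜) in
/-- The trigraded `Λ₃`-module `Hom_𝕜(Λ₃, V)` coinduced from a trigraded vector space `V`: `Λ₃` acts by
`(∂ f)(y) = f (y ∂)`. As `Λ₃` is a Frobenius algebra whose top degree is `(1,1,1)`, this is the
free module `Λ₃ ⊗ V {-1,-1,-1}`. -/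
def cofree : TriMod 𝕜 where
  X i j k := CofreeX V i j k
  d1 {i i'} j k h := h ▸ cofree1 V i j k
  d2 i {j j'} k h := h ▸ cofree2 V i j k
  d3 i j {k k'} h := h ▸ cofree3 V i j k
  d1_d1 j k h h' x := by subst h h'; ext <;> simp
  d2_d2 i _ _ _ k h h' x := by subst h h'; ext <;> simp
  d3_d3 i j _ _ _ h h' x := by subst h h'; ext <;> simp
  d1_d2 k h h' x := by subst h h'; ext <;> simp
  d1_d3 j _ _ h h' x := by subst h h'; ext <;> simp
  d2_d3 i _ _ _ _ h h' x := by subst h h'; ext <;> simp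

variable {V}

variable {W : ℤ → ℤ → ℤ → Type u} [∀ i j k, AddCommGroup (W i j k)] [∀ i j k, Module 𝕜 (W i j k)]

/-- The linear map underlying `cofreeMap`. -/
@[simps] def cofreeMapX (φ : ∀ i j k, V i j k →ₗ[𝕜] W i j k) (i j k : ℤ) :
    CofreeX V i j k →ₗ[𝕜] CofreeX W i j k where
  toFun x := ⟨φ _ _ _ x.e, φ _ _ _ x.a1, φ _ _ _ x.a2, φ _ _ _ x.a3, φ _ _ _ x.a12,
    φ _ _ _ x.a13, φ _ _ _ x.a23, φ _ _ _ x.a123⟩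
  map_add' x y := by ext <;> simp
  map_smul' c x := by ext <;> simp

theorem cofreeMapX_cofree1 (φ : ∀ i j k, V i j k →ₗ[𝕜] W i j k) (i j k : ℤ)
    (x : CofreeX V i j k) : cofreeMapX φ (i + 1) j k (cofree1 (𝕜 := 𝕜) V i j k x) =
      cofree1 (𝕜 := 𝕜) W i j k (cofreeMapX φ i j k x) := by
  ext <;> simp

theorem cofreeMapX_cofree2 (φ : ∀ i j k, V i j k →ₗ[𝕜] W i j k) (i j k : ℤ)
    (x : CofreeX V i j k) : cofreeMapX φ i (j + 1) k (cofree2 (𝕜 := 𝕜) V i j k x) =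
      cofree2 (𝕜 := 𝕜) W i j k (cofreeMapX φ i j k x) := by
  ext <;> simp

theorem cofreeMapX_cofree3 (φ : ∀ i j k, V i j k →ₗ[𝕜] W i j k) (i j k : ℤ)
    (x : CofreeX V i j k) : cofreeMapX φ i j (k + 1) (cofree3 (𝕜 := 𝕜) V i j k x) =
      cofree3 (𝕜 := 𝕜) W i j k (cofreeMapX φ i j k x) := by
  ext <;> simp

/-- Functoriality of `V ↦ Hom_𝕜(Λ₃, V)` in the trigraded vector space `V`. -/
def cofreeMap (φ : ∀ i j k, V i j k →ₗ[𝕜] W i j k) : cofree 𝕜 V ⟶ cofree 𝕜 W where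
  app := cofreeMapX φ
  comm1 {i _} j k h x := by
    subst h
    exact cofreeMapX_cofree1 φ i j k x
  comm2 i {j _} k h x := by
    subst h
    exact cofreeMapX_cofree2 φ i j k x
  comm3 i j {k _} h x := by
    subst h
    exact cofreeMapX_cofree3 φ i j k x

end Cofree

/-- The linear map underlying `toCofree`. -/
@[simps] def toCofreeX (M : TriMod 𝕜) (i j k : ℤ) : M.X i j k →ₗ[𝕜] CofreeX M.X i j k where
  toFun m := ⟨m, M.d1 j k rfl m, M.d2 i k rfl m, M.d3 i j rfl m,
    M.d1 (j + 1) k rfl (M.d2 i k rfl m), M.d1 j (k + 1) rfl (M.d3 i j rfl m),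
    M.d2 i (k + 1) rfl (M.d3 i j rfl m),
    M.d1 (j + 1) (k + 1) rfl (M.d2 i (k + 1) rfl (M.d3 i j rfl m))⟩
  map_add' x y := by ext <;> simp
  map_smul' c x := by ext <;> simp

/-- The canonical embedding `M ⟶ Hom_𝕜(Λ₃, M)`, `m ↦ (y ↦ y m)`. -/
def toCofree (M : TriMod 𝕜) : M ⟶ cofree 𝕜 M.X where
  app := toCofreeX M
  comm1 {i _} j k h x := by
    subst h
    have h12 := eq_neg_of_add_eq_zero_right (M.d1_d2 k (rfl : i + 1 = _) (rfl : j + 1 = _) x)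
    have h13 := eq_neg_of_add_eq_zero_right (M.d1_d3 j (rfl : i + 1 = _) (rfl : k + 1 = _) x)
    have h23 := eq_neg_of_add_eq_zero_right
      (M.d1_d2 (k + 1) (rfl : i + 1 = _) (rfl : j + 1 = _) (M.d3 i j rfl x))
    change toCofreeX M _ _ _ (M.d1 j k rfl x) = cofree1 (𝕜 := 𝕜) M.X i j k (toCofreeX M _ _ _ x)
    ext <;> simp [h12, h13, h23, M.d1_d1]
  comm2 i {j _} k h x := by
    subst h
    have h23 := eq_neg_of_add_eq_zero_right (M.d2_d3 i (rfl : j + 1 = _) (rfl : k + 1 = _) x)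
    change toCofreeX M _ _ _ (M.d2 i k rfl x) = cofree2 (𝕜 := 𝕜) M.X i j k (toCofreeX M _ _ _ x)
    ext <;> simp [h23, M.d2_d2]
  comm3 i j {k _} h x := by
    subst h
    change toCofreeX M _ _ _ (M.d3 i j rfl x) = cofree3 (𝕜 := 𝕜) M.X i j k (toCofreeX M _ _ _ x)
    ext <;> simp [M.d3_d3]

theorem toCofree_naturality {M N : TriMod 𝕜} (f : M ⟶ N) :
    f ≫ toCofree N = toCofree M ≫ cofreeMap f.app := by
  ext i j k x
  change toCofreeX N _ _ _ (f.app i j k x) = cofreeMapX f.app _ _ _ (toCofreeX M _ _ _ x)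
  ext <;> simp [f.comm1, f.comm2, f.comm3]

theorem cofreeMap_id (M : TriMod 𝕜) : cofreeMap (Hom.app (𝟙 M)) = 𝟙 (cofree 𝕜 M.X) := rfl

theorem cofreeMap_comp {M N P : TriMod 𝕜} (f : M ⟶ N) (g : N ⟶ P) :
    cofreeMap (f ≫ g).app = cofreeMap f.app ≫ cofreeMap g.app := rfl

/-! ### The suspension -/

/-- The suspension of `M`: the cokernel of the embedding of `M` into `Hom_𝕜(Λ₃, M)`. -/
def susp (M : TriMod 𝕜) : TriMod 𝕜 := coker (toCofree M)

/-- The projection `Hom_𝕜(Λ₃, M) ⟶ susp M`. -/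
def toSusp (M : TriMod 𝕜) : cofree 𝕜 M.X ⟶ susp M := cokerπ (toCofree M)

instance (M : TriMod 𝕜) : Epi (toSusp M) := inferInstanceAs (Epi (cokerπ _))

theorem toCofree_toSusp (M : TriMod 𝕜) : toCofree M ≫ toSusp M = 0 := comp_cokerπ _

/-- The suspension of a morphism. -/
def suspMap {M N : TriMod 𝕜} (f : M ⟶ N) : susp M ⟶ susp N :=
  cokerDesc (toCofree M) (cofreeMap f.app ≫ toSusp N) (by
    rw [← Category.assoc, ← toCofree_naturality, Category.assoc, toCofree_toSusp, comp_zero])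

theorem toSusp_suspMap {M N : TriMod 𝕜} (f : M ⟶ N) :
    toSusp M ≫ suspMap f = cofreeMap f.app ≫ toSusp N := cokerπ_desc _ _ _

theorem toSusp_suspMap_assoc {M N P : TriMod 𝕜} (f : M ⟶ N) (g : susp N ⟶ P) :
    toSusp M ≫ suspMap f ≫ g = cofreeMap f.app ≫ toSusp N ≫ g := rfl

/-- The suspension functor on trigraded `Λ₃`-modules. -/
def suspFunctor : TriMod 𝕜 ⥤ TriMod 𝕜 where
  obj := susp
  map := suspMap
  map_id M := by
    rw [← cancel_epi (toSusp M), toSusp_suspMap, cofreeMap_id, Category.id_comp, Category.comp_id]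
  map_comp {M N P} f g := by
    rw [← cancel_epi (toSusp M), toSusp_suspMap, cofreeMap_comp, Category.assoc,
      ← toSusp_suspMap, toSusp_suspMap_assoc]

theorem suspMap_add {M N : TriMod 𝕜} (f g : M ⟶ N) : suspMap (f + g) = suspMap f + suspMap g := by
  rw [← cancel_epi (toSusp M), Preadditive.comp_add, toSusp_suspMap, toSusp_suspMap,
    toSusp_suspMap, ← Preadditive.add_comp]
  rfl

instance : (suspFunctor (𝕜 := 𝕜)).Additive where
  map_add := suspMap_add _ _

/-! ### Coinduced modules are projective -/

section

variable {V : ℤ → ℤ → ℤ → Type u} [∀ i j k, AddCommGroup (V i j k)] [∀ i j k, Module 𝕜 (V i j k)]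

variable (𝕜 V) in
/-- Families of linear maps `V ⟶ N` of degree `(-1,-1,-1)`. -/
abbrev TopMap (N : TriMod 𝕜) := ∀ ⦃i i' j j' k k' : ℤ⦄, i + 1 = i' → j + 1 = j' → k + 1 = k' →
  (V i' j' k' →ₗ[𝕜] N.X i j k)

/-- The formula for the morphism `cofree 𝕜 V ⟶ N` with a given restriction to the generators. -/
def fromAux (N : TriMod 𝕜) (l : TopMap 𝕜 V N) {i j k p q r : ℤ} (hp : p + 1 = i) (hq : q + 1 = j)
    (hr : r + 1 = k) (x : CofreeX V i j k) : N.X i j k :=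
  l rfl rfl rfl x.a123 + N.d1 j k hp (l hp rfl rfl x.a23) - N.d2 i k hq (l rfl hq rfl x.a13) +
    N.d3 i j hr (l rfl rfl hr x.a12) + N.d1 j k hp (N.d2 p k hq (l hp hq rfl x.a3)) -
    N.d1 j k hp (N.d3 p j hr (l hp rfl hr x.a2)) + N.d2 i k hq (N.d3 i q hr (l rfl hq hr x.a1)) +
    N.d1 j k hp (N.d2 p k hq (N.d3 p q hr (l hp hq hr x.e)))

/-- The linear map underlying `fromCofree`. -/
def fromCofreeX (N : TriMod 𝕜) (l : TopMap 𝕜 V N) (i j k : ℤ) :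
    CofreeX V i j k →ₗ[𝕜] N.X i j k where
  toFun := fromAux N l (sub_add_cancel i 1) (sub_add_cancel j 1) (sub_add_cancel k 1)
  map_add' x y := by simp only [fromAux, CofreeX.add_e, CofreeX.add_a1, CofreeX.add_a2,
    CofreeX.add_a3, CofreeX.add_a12, CofreeX.add_a13, CofreeX.add_a23, CofreeX.add_a123, map_add]
                     abel
  map_smul' c x := by simp [fromAux, smul_add, smul_sub]

theorem fromCofreeX_eq (N : TriMod 𝕜) (l : TopMap 𝕜 V N) {i j k p q r : ℤ} (hp : p + 1 = i)
    (hq : q + 1 = j) (hr : r + 1 = k) (x : CofreeX V i j k) :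
    fromCofreeX N l i j k x = fromAux N l hp hq hr x := by
  obtain rfl : p = i - 1 := by omega
  obtain rfl : q = j - 1 := by omega
  obtain rfl : r = k - 1 := by omega
  rfl

/-- The morphism `cofree 𝕜 V ⟶ N` with a given restriction to the generators. -/
def fromCofree (N : TriMod 𝕜) (l : TopMap 𝕜 V N) : cofree 𝕜 V ⟶ N where
  app := fromCofreeX N l
  comm1 {i i'} j k h := by
    subst h
    intro (x : CofreeX V i j k)
    obtain ⟨i, rfl⟩ : ∃ p, p + 1 = i := ⟨i - 1, by simp⟩
    obtain ⟨j, rfl⟩ : ∃ p, p + 1 = j := ⟨j - 1, by simp⟩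
    obtain ⟨k, rfl⟩ : ∃ p, p + 1 = k := ⟨k - 1, by simp⟩
    change fromCofreeX N l _ _ _ (cofree1 (𝕜 := 𝕜) V _ _ _ x) = N.d1 _ _ rfl (fromCofreeX N l _ _ _ x)
    rw [fromCofreeX_eq N l rfl rfl rfl, fromCofreeX_eq N l rfl rfl rfl]
    simp [fromAux, N.d1_d1]
    abel
  comm2 i {j j'} k h := by
    subst h
    intro (x : CofreeX V i j k)
    obtain ⟨i, rfl⟩ : ∃ p, p + 1 = i := ⟨i - 1, by simp⟩
    obtain ⟨j, rfl⟩ : ∃ p, p + 1 = j := ⟨j - 1, by simp⟩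
    obtain ⟨k, rfl⟩ : ∃ p, p + 1 = k := ⟨k - 1, by simp⟩
    change fromCofreeX N l _ _ _ (cofree2 (𝕜 := 𝕜) V _ _ _ x) = N.d2 _ _ rfl (fromCofreeX N l _ _ _ x)
    rw [fromCofreeX_eq N l rfl rfl rfl, fromCofreeX_eq N l rfl rfl rfl]
    have h12 := fun y => eq_neg_of_add_eq_zero_right
      (N.d1_d2 (i := i) (j := j + 1) (k + 1) rfl rfl y)
    simp [fromAux, N.d2_d2, h12]
  comm3 i j {k k'} h := by
    subst h
    intro (x : CofreeX V i j k)
    obtain ⟨i, rfl⟩ : ∃ p, p + 1 = i := ⟨i - 1, by simp⟩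
    obtain ⟨j, rfl⟩ : ∃ p, p + 1 = j := ⟨j - 1, by simp⟩
    obtain ⟨k, rfl⟩ : ∃ p, p + 1 = k := ⟨k - 1, by simp⟩
    change fromCofreeX N l _ _ _ (cofree3 (𝕜 := 𝕜) V _ _ _ x) = N.d3 _ _ rfl (fromCofreeX N l _ _ _ x)
    rw [fromCofreeX_eq N l rfl rfl rfl, fromCofreeX_eq N l rfl rfl rfl]
    have h13 := fun y => eq_neg_of_add_eq_zero_right
      (N.d1_d3 (i := i) (k := k + 1) (j + 1) rfl rfl y)
    have h23 := fun i' y => eq_neg_of_add_eq_zero_right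
      (N.d2_d3 (j := j) (k := k + 1) i' rfl rfl y)
    simp [fromAux, N.d3_d3, h13, h23]
    abel

theorem fromCofree_comp {N P : TriMod 𝕜} (l : TopMap 𝕜 V N) (f : N ⟶ P) :
    fromCofree N l ≫ f = fromCofree P (fun i _ j _ k _ hi hj hk => f.app i j k ∘ₗ l hi hj hk) := by
  ext i j k x
  change f.app i j k (fromAux N l (sub_add_cancel i 1) (sub_add_cancel j 1) (sub_add_cancel k 1) x) =
    fromAux P (fun i _ j _ k _ hi hj hk => f.app i j k ∘ₗ l hi hj hk) (sub_add_cancel i 1)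
      (sub_add_cancel j 1) (sub_add_cancel k 1) x
  simp [fromAux, f.comm1, f.comm2, f.comm3]

variable (𝕜 V) in
/-- The inclusion of the generators. -/
def gens : TopMap 𝕜 V (cofree 𝕜 V) := fun i _ j _ k _ hi hj hk => by
  subst hi hj hk
  exact
    { toFun := fun v => (⟨0, 0, 0, 0, 0, 0, 0, v⟩ : CofreeX V i j k)
      map_add' := fun x y => by
        change (_ : CofreeX V i j k) = (_ : CofreeX V i j k) + (_ : CofreeX V i j k)
        ext <;> simp
      map_smul' := fun c x => by
        change (_ : CofreeX V i j k) = c • (_ : CofreeX V i j k)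
        ext <;> simp }

theorem fromCofree_gens : fromCofree _ (gens 𝕜 V) = 𝟙 (cofree 𝕜 V) := by
  ext i j k x
  obtain ⟨i, rfl⟩ : ∃ p, p + 1 = i := ⟨i - 1, by simp⟩
  obtain ⟨j, rfl⟩ : ∃ p, p + 1 = j := ⟨j - 1, by simp⟩
  obtain ⟨k, rfl⟩ : ∃ p, p + 1 = k := ⟨k - 1, by simp⟩
  refine (fromCofreeX_eq _ (gens 𝕜 V) rfl rfl rfl x).trans ?_
  have key : ∀ y : CofreeX V (i + 1) (j + 1) (k + 1),
      (⟨0, 0, 0, 0, 0, 0, 0, y.a123⟩ + cofree1 (𝕜 := 𝕜) V i (j + 1) (k + 1) ⟨0, 0, 0, 0, 0, 0, 0, y.a23⟩ -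
      cofree2 (𝕜 := 𝕜) V _ _ _ ⟨0, 0, 0, 0, 0, 0, 0, y.a13⟩ +
      cofree3 (𝕜 := 𝕜) V _ _ _ ⟨0, 0, 0, 0, 0, 0, 0, y.a12⟩ +
      cofree1 (𝕜 := 𝕜) V _ _ _ (cofree2 (𝕜 := 𝕜) V _ _ _ ⟨0, 0, 0, 0, 0, 0, 0, y.a3⟩) -
      cofree1 (𝕜 := 𝕜) V _ _ _ (cofree3 (𝕜 := 𝕜) V _ _ _ ⟨0, 0, 0, 0, 0, 0, 0, y.a2⟩) +
      cofree2 (𝕜 := 𝕜) V _ _ _ (cofree3 (𝕜 := 𝕜) V _ _ _ ⟨0, 0, 0, 0, 0, 0, 0, y.a1⟩) +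
      cofree1 (𝕜 := 𝕜) V _ _ _ (cofree2 (𝕜 := 𝕜) V _ _ _
        (cofree3 (𝕜 := 𝕜) V _ _ _ ⟨0, 0, 0, 0, 0, 0, 0, y.e⟩)) : CofreeX V (i + 1) (j + 1) (k + 1)) = y := by
    intro y
    ext <;> simp [sub_eq_add_neg]
  exact key x

instance cofree_projective : Projective (cofree 𝕜 V) where
  factors {E X} f e _ := by
    choose s hs using fun i j k => LinearMap.exists_rightInverse_of_surjective (e.app i j k)
      (LinearMap.range_eq_top.2 (surjective_of_epi e i j k))
    have hf : fromCofree X (fun i _ j _ k _ hi hj hk => f.app i j k ∘ₗ gens 𝕜 V hi hj hk) = f := by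
      rw [← fromCofree_comp, fromCofree_gens, Category.id_comp]
    refine ⟨fromCofree E fun i _ j _ k _ hi hj hk =>
      s i j k ∘ₗ f.app i j k ∘ₗ gens 𝕜 V hi hj hk, ?_⟩
    rw [fromCofree_comp]
    refine Eq.trans ?_ hf
    congr 1
    funext i _ j _ k _ hi hj hk
    ext v
    exact congrArg (fun t => t (f.app i j k (gens 𝕜 V hi hj hk v))) (hs i j k)

end

/-- The identification of the degree `(i'-1, j'-1, k'-1)` part with the degree `(i,j,k)` part. -/
def unshift (P : TriMod 𝕜) :
    TopMap 𝕜 (fun i j k => P.X (i - 1) (j - 1) (k - 1)) P := fun i i' j j' k k' hi hj hk => by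
  obtain rfl : i = i' - 1 := by omega
  obtain rfl : j = j' - 1 := by omega
  obtain rfl : k = k' - 1 := by omega
  exact LinearMap.id

theorem unshift_surjective (P : TriMod 𝕜) {i i' j j' k k' : ℤ} (hi : i + 1 = i') (hj : j + 1 = j')
    (hk : k + 1 = k') : Function.Surjective (unshift P hi hj hk) := by
  obtain rfl : i = i' - 1 := by omega
  obtain rfl : j = j' - 1 := by omega
  obtain rfl : k = k' - 1 := by omega
  exact Function.surjective_id

/-- Every `P` is the target of an epimorphism from a coinduced module. -/
theorem epi_fromCofree_unshift (P : TriMod 𝕜) : Epi (fromCofree P (unshift P)) :=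
  epi_of_surjective _ fun i j k y => by
    obtain ⟨v, rfl⟩ := unshift_surjective P (rfl : i + 1 = _) (rfl : j + 1 = _) (rfl : k + 1 = _) y
    refine ⟨(⟨0, 0, 0, 0, 0, 0, 0, v⟩ :
      CofreeX (fun i j k => P.X (i - 1) (j - 1) (k - 1)) i j k), ?_⟩
    change fromAux P _ _ _ _ _ = _
    simp [fromAux]

/-- The embedding of a coinduced module into its coinduced module is split. -/
theorem toCofree_cofree_split (V : ℤ → ℤ → ℤ → Type u) [∀ i j k, AddCommGroup (V i j k)]
    [∀ i j k, Module 𝕜 (V i j k)] :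
    ∃ r, toCofree (cofree 𝕜 V) ≫ r = 𝟙 (cofree 𝕜 V) := by
  refine ⟨cofreeMap (V := (cofree 𝕜 V).X) fun i j k =>
    { toFun := fun x => CofreeX.e x, map_add' := fun _ _ => rfl, map_smul' := fun _ _ => rfl }, ?_⟩
  ext i j k x
  rfl

theorem susp_cofree_projective (V : ℤ → ℤ → ℤ → Type u) [∀ i j k, AddCommGroup (V i j k)]
    [∀ i j k, Module 𝕜 (V i j k)] : Projective (susp (cofree 𝕜 V)) := by
  obtain ⟨r, hr⟩ := toCofree_cofree_split (𝕜 := 𝕜) V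
  have h : toCofree (cofree 𝕜 V) ≫ (𝟙 _ - r ≫ toCofree (cofree 𝕜 V)) = 0 := by
    rw [Preadditive.comp_sub, ← Category.assoc, hr, Category.id_comp, Category.comp_id, sub_self]
  let s : susp (cofree 𝕜 V) ⟶ cofree 𝕜 (cofree 𝕜 V).X := cokerDesc _ _ h
  have hs : toSusp (cofree 𝕜 V) ≫ s = 𝟙 _ - r ≫ toCofree (cofree 𝕜 V) := cokerπ_desc _ _ h
  have hs' : s ≫ toSusp (cofree 𝕜 V) = 𝟙 (susp (cofree 𝕜 V)) := by
    rw [← cancel_epi (toSusp (cofree 𝕜 V)), ← Category.assoc, hs, Preadditive.sub_comp,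
      Category.assoc, toCofree_toSusp]
    simp
  exact (Retract.mk s (toSusp _) hs').projective

theorem susp_projective (P : TriMod 𝕜) [Projective P] : Projective (susp P) := by
  have := epi_fromCofree_unshift P
  have := susp_cofree_projective (𝕜 := 𝕜) (fun i j k => P.X (i - 1) (j - 1) (k - 1))
  have h : Retract P (cofree 𝕜 (fun i j k => P.X (i - 1) (j - 1) (k - 1))) :=
    ⟨Projective.factorThru (𝟙 P) (fromCofree P (unshift P)), _, Projective.factorThru_comp _ _⟩
  exact Retract.projective (Y := susp (cofree 𝕜 (fun i j k => P.X (i - 1) (j - 1) (k - 1))))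
    (h.map suspFunctor)

/-! ### The stable category -/

/-- Two morphisms are identified in the stable category if their difference factors through a
projective object. -/
def stableRel (𝕜 : Type u) [Field 𝕜] : HomRel (TriMod 𝕜) := fun M N f g =>
  ∃ (P : TriMod 𝕜) (_ : Projective P) (a : M ⟶ P) (b : P ⟶ N), f - g = a ≫ b

theorem stableRel_iff {M N : TriMod 𝕜} (f g : M ⟶ N) :
    stableRel 𝕜 f g ↔ ∃ a, f - g = a ≫ fromCofree N (unshift N) := by
  constructor
  · rintro ⟨P, _, a, b, h⟩
    have := epi_fromCofree_unshift N
    exact ⟨a ≫ Projective.factorThru b (fromCofree N (unshift N)), by simp [h]⟩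
  · rintro ⟨a, h⟩
    exact ⟨_, inferInstance, a, _, h⟩

instance : Congruence (stableRel 𝕜) where
  equivalence :=
    { refl := fun f => (stableRel_iff _ _).2 ⟨0, by simp⟩
      symm := fun {f g} h => by
        obtain ⟨a, h⟩ := (stableRel_iff _ _).1 h
        exact (stableRel_iff _ _).2 ⟨-a, by rw [Preadditive.neg_comp, ← h, neg_sub]⟩
      trans := fun {f g k} h h' => by
        obtain ⟨a, h⟩ := (stableRel_iff _ _).1 h
        obtain ⟨a', h'⟩ := (stableRel_iff _ _).1 h'
        exact (stableRel_iff _ _).2 ⟨a + a', by rw [Preadditive.add_comp, ← h, ← h']; abel⟩ }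
  comp_left f g g' := by
    rintro ⟨P, hP, a, b, h⟩
    exact ⟨P, hP, f ≫ a, b, by rw [← Preadditive.comp_sub, h, Category.assoc]⟩
  comp_right g := by
    rintro ⟨P, hP, a, b, h⟩
    exact ⟨P, hP, a, b ≫ g, by rw [← Preadditive.sub_comp, h, Category.assoc]⟩

theorem stableRel_add ⦃M N : TriMod 𝕜⦄ (f₁ f₂ g₁ g₂ : M ⟶ N) (h : stableRel 𝕜 f₁ f₂)
    (h' : stableRel 𝕜 g₁ g₂) : stableRel 𝕜 (f₁ + g₁) (f₂ + g₂) := by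
  obtain ⟨a, h⟩ := (stableRel_iff _ _).1 h
  obtain ⟨a', h'⟩ := (stableRel_iff _ _).1 h'
  exact (stableRel_iff _ _).2 ⟨a + a', by rw [Preadditive.add_comp, ← h, ← h']; abel⟩

end TriMod

/-- The stable category `𝓢𝓜₃` of trigraded `Λ₃`-modules: its objects are those of `𝓜₃` and its
morphisms are those of `𝓜₃` modulo the morphisms that factor through a projective object. -/
def StabMod (𝕜 : Type u) [Field 𝕜] : Type (u + 1) := CategoryTheory.Quotient (TriMod.stableRel 𝕜)

namespace StabMod

variable (𝕜 : Type u) [Field 𝕜]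

instance : Category (StabMod 𝕜) := inferInstanceAs (Category (CategoryTheory.Quotient _))

instance : Preadditive (StabMod 𝕜) :=
  CategoryTheory.Quotient.preadditive (TriMod.stableRel 𝕜) TriMod.stableRel_add

/-- The projection `𝓜₃ ⥤ 𝓢𝓜₃`. -/
def proj : TriMod 𝕜 ⥤ StabMod 𝕜 := CategoryTheory.Quotient.functor _

instance : (proj 𝕜).Additive where
  map_add := rfl

/-- The shift functor `[1]` of `𝓢𝓜₃`, induced by `TriMod.susp`. -/
def shift : StabMod 𝕜 ⥤ StabMod 𝕜 :=
  CategoryTheory.Quotient.lift _ (TriMod.suspFunctor ⋙ proj 𝕜) (by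
    rintro M N f g ⟨P, hP, a, b, h⟩
    have := TriMod.susp_projective P
    refine CategoryTheory.Quotient.sound _ ⟨_, this, TriMod.suspFunctor.map a,
      TriMod.suspFunctor.map b, ?_⟩
    rw [← Functor.map_sub, h, Functor.map_comp]
    rfl)

variable {𝕜} in
/-- A triangle `X ⟶ Y ⟶ Z ⟶ X[1]` of `𝓢𝓜₃` is distinguished if it is isomorphic to the
triangle `M ⟶ N ⟶ C ⟶ M[1]` of a morphism `f : M ⟶ N` of `𝓜₃`, where `C` is the cone of `f`,
that is, the pushout of `f` and of the embedding `M ⟶ Hom_𝕜(Λ₃, M)`, and `C ⟶ M[1]` is the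
morphism which is zero on `N` and the projection on `Hom_𝕜(Λ₃, M)`. -/
def IsDistinguished {X Y Z : StabMod 𝕜} (u : X ⟶ Y) (v : Y ⟶ Z) (w : Z ⟶ (shift 𝕜).obj X) :
    Prop :=
  ∃ (M N C : TriMod 𝕜) (f : M ⟶ N) (c : N ⟶ C) (e : TriMod.cofree 𝕜 M.X ⟶ C) (δ : C ⟶ M.susp)
    (α : X ≅ (proj 𝕜).obj M) (β : Y ≅ (proj 𝕜).obj N) (γ : Z ≅ (proj 𝕜).obj C),
    IsPushout f M.toCofree c e ∧ c ≫ δ = 0 ∧ e ≫ δ = M.toSusp ∧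
    u ≫ β.hom = α.hom ≫ (proj 𝕜).map f ∧ v ≫ γ.hom = β.hom ≫ (proj 𝕜).map c ∧
    w ≫ (shift 𝕜).map α.hom = γ.hom ≫ (proj 𝕜).map δ

end StabMod

/-! ### The functor `𝓖_∞` -/

namespace GrMod

variable {𝕜 : Type u} [Field 𝕜]

/-- The homogeneous part `(r)Mʲ` of a graded `A`-module `M`. -/
def part (M : GrMod 𝕜) (r j : ℤ) : Submodule 𝕜 M.carrier :=
  M.gr j ⊓ LinearMap.range (M.act (ZigzagAlg.e 𝕜 r))

theorem act_a_mem (M : GrMod 𝕜) {r s j : ℤ} (h : r + 1 = s) {m : M.carrier} (hm : m ∈ M.part r j) :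
    M.act (ZigzagAlg.a 𝕜 r) m ∈ M.part s j := by
  subst h
  refine ⟨by simpa using M.act_mem (.a r) hm.1, M.act (ZigzagAlg.a 𝕜 r) m, ?_⟩
  rw [← M.act_mul, ZigzagAlg.a_mul_e]

theorem act_b_mem (M : GrMod 𝕜) {r s j j' : ℤ} (h : r - 1 = s) (hj : j + 1 = j') {m : M.carrier}
    (hm : m ∈ M.part r j) : M.act (ZigzagAlg.b 𝕜 r) m ∈ M.part s j' := by
  subst h hj
  refine ⟨M.act_mem (.b r) hm.1, M.act (ZigzagAlg.b 𝕜 r) m, ?_⟩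
  rw [← M.act_mul, ZigzagAlg.b_mul_e]

theorem Hom.map_part {M N : GrMod 𝕜} (f : M ⟶ N) {r j : ℤ} {m : M.carrier} (hm : m ∈ M.part r j) :
    f.lin m ∈ N.part r j := by
  obtain ⟨h, x, rfl⟩ := hm
  exact ⟨f.map_gr h, f.lin x, (f.map_act _ _).symm⟩

end GrMod

namespace GInf

variable {𝕜 : Type u} [Field 𝕜] (M : CochainComplex (GrMod 𝕜) ℤ)

/-- `∂₁ = D₁` is the action of the arrow `(r|r+1)`, `r = i - j`. -/
def d1 {i i' : ℤ} (j k : ℤ) (h : i + 1 = i') :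
    (M.X k).part (i - j) j →ₗ[𝕜] (M.X k).part (i' - j) j :=
  ((M.X k).act (ZigzagAlg.a 𝕜 (i - j))).restrict fun _ hm => (M.X k).act_a_mem (by omega) hm

/-- `∂₂ = (-1)^r D₂`, where `D₂` is the action of the arrow `(r|r-1)`, `r = i - j`. -/
def d2 (i : ℤ) {j j' : ℤ} (k : ℤ) (h : j + 1 = j') :
    (M.X k).part (i - j) j →ₗ[𝕜] (M.X k).part (i - j') j' :=
  (i - j).negOnePow •
    ((M.X k).act (ZigzagAlg.b 𝕜 (i - j))).restrict fun _ hm => (M.X k).act_b_mem (by omega) h hm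

/-- `∂₃ = (-1)^(r+k) d`, `r = i - j`. -/
def d3 (i j : ℤ) {k k' : ℤ} (_ : k + 1 = k') :
    (M.X k).part (i - j) j →ₗ[𝕜] (M.X k').part (i - j) j :=
  (i - j + k).negOnePow • (M.d k k').lin.restrict fun _ hm => (M.d k k').map_part hm

theorem coe_d1 {i i' : ℤ} (j k : ℤ) (h : i + 1 = i') (x : (M.X k).part (i - j) j) :
    (d1 M j k h x : (M.X k).carrier) = (M.X k).act (ZigzagAlg.a 𝕜 (i - j)) x := rfl

theorem coe_d2 (i : ℤ) {j j' : ℤ} (k : ℤ) (h : j + 1 = j') (x : (M.X k).part (i - j) j) :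
    (d2 M i k h x : (M.X k).carrier) =
      (i - j).negOnePow • (M.X k).act (ZigzagAlg.b 𝕜 (i - j)) x := rfl

theorem coe_d3 (i j : ℤ) {k k' : ℤ} (h : k + 1 = k') (x : (M.X k).part (i - j) j) :
    (d3 M i j h x : (M.X k').carrier) = (i - j + k).negOnePow • (M.d k k').lin x := rfl

/-- The trigraded `Λ₃`-module attached to a complex `M` of graded `A`-modules: its degree
`(i,j,k)` part is `(i-j)M_k^j`. -/
def obj : TriMod 𝕜 where
  X i j k := (M.X k).part (i - j) j
  d1 := d1 M
  d2 := d2 M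
  d3 := d3 M
  d1_d1 {i i' i''} j k h h' x := by
    ext
    have : i' - j = i - j + 1 := by omega
    rw [coe_d1, coe_d1, this, ← (M.X k).act_mul, ZigzagAlg.a_mul_a]
    simp
  d2_d2 i {j j' j''} k h h' x := by
    ext
    have : i - j' = i - j - 1 := by omega
    rw [coe_d2, coe_d2, this, Units.smul_def, Units.smul_def, map_zsmul, ← (M.X k).act_mul, ZigzagAlg.b_mul_b]
    simp
  d3_d3 i j {k k' k''} h h' x := by
    ext
    have : (M.d k' k'').lin ((M.d k k').lin x) = 0 :=
      congrArg (fun f => GrMod.Hom.lin f (x : (M.X k).carrier)) (M.d_comp_d k k' k'')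
    rw [coe_d3, coe_d3, Units.smul_def, Units.smul_def, map_zsmul, this]
    simp
  d1_d2 {i i' j j'} k h h' x := by
    ext
    have e1 : i - j' = i - j - 1 := by omega
    have e2 : i' - j = i - j + 1 := by omega
    rw [Submodule.coe_add, coe_d1, coe_d2, coe_d2, coe_d1, e1, e2, Units.smul_def, Units.smul_def,
      map_zsmul, ← (M.X k).act_mul, ← (M.X k).act_mul, ZigzagAlg.b_mul_a, Int.negOnePow_succ]
    simp
  d1_d3 {i i'} j {k k'} h h' x := by
    ext
    have e1 : i' - j + k = i - j + k + 1 := by omega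
    rw [Submodule.coe_add, coe_d1, coe_d3, coe_d3, coe_d1, e1, Units.smul_def, Units.smul_def,
      map_zsmul, (M.d k k').map_act, Int.negOnePow_succ]
    simp
  d2_d3 i {j j' k k'} h h' x := by
    ext
    have e1 : i - j + k = i - j' + k + 1 := by omega
    rw [Submodule.coe_add, coe_d2, coe_d3, coe_d3, coe_d2, e1, Units.smul_def, Units.smul_def,
      Units.smul_def, Units.smul_def, map_zsmul, map_zsmul, (M.d k k').map_act, Int.negOnePow_succ,
      smul_comm]
    simp

variable {M} in
/-- The morphism of trigraded `Λ₃`-modules attached to a morphism of complexes. -/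
def map {N : CochainComplex (GrMod 𝕜) ℤ} (f : M ⟶ N) : obj M ⟶ obj N where
  app i j k := (f.f k).lin.restrict fun _ hm => (f.f k).map_part hm
  comm1 j k h x := Subtype.ext ((f.f k).map_act _ _)
  comm2 {i j j'} k h x := Subtype.ext (by
    refine (map_zsmul (f.f k).lin _ _).trans ?_
    exact congrArg _ ((f.f k).map_act _ _))
  comm3 i j {k k'} h x := Subtype.ext (by
    refine (map_zsmul (f.f k').lin _ _).trans ?_
    exact congrArg _ (congrArg (fun g => GrMod.Hom.lin g (Subtype.val x)) (f.comm k k')).symm)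

end GInf

/-- The functor `𝓖_∞` from complexes of graded `A`-modules (that is, graded dg modules over `(A,d)`,
with `A` in homological degree `0`) to trigraded `Λ₃`-modules. -/
def GInf (𝕜 : Type u) [Field 𝕜] : CochainComplex (GrMod 𝕜) ℤ ⥤ TriMod 𝕜 where
  obj := GInf.obj
  map := GInf.map

instance (𝕜 : Type u) [Field 𝕜] : (GInf 𝕜).Additive where

theorem iSupIndep_of_projections {ι 𝕜 V : Type*} [Ring 𝕜] [AddCommGroup V] [Module 𝕜 V]
    (p : ι → Submodule 𝕜 V) (P : ι → V →ₗ[𝕜] V) (h₁ : ∀ i, ∀ x ∈ p i, P i x = x)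
    (h₂ : ∀ i j, j ≠ i → ∀ x ∈ p j, P i x = 0) : iSupIndep p := by
  intro i
  rw [Submodule.disjoint_def]
  intro x hx hx'
  have h : ⨆ j, ⨆ (_ : j ≠ i), p j ≤ LinearMap.ker (P i) :=
    iSup₂_le fun j hj y hy => h₂ i j hj y hy
  rw [← h₁ i x hx]
  exact h hx'

theorem DirectSum.IsInternal.exists_projection {ι 𝕜 V : Type*} [DecidableEq ι] [Ring 𝕜]
    [AddCommGroup V] [Module 𝕜 V] {p : ι → Submodule 𝕜 V} (h : DirectSum.IsInternal p) (i : ι) :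
    ∃ P : V →ₗ[𝕜] V, (∀ x ∈ p i, P x = x) ∧
      ∀ j, j ≠ i → ∀ x ∈ p j, P x = 0 := by
  have hinj : Function.Bijective (DirectSum.coeLinearMap p) := h
  let e := LinearEquiv.ofBijective _ hinj
  have he : ∀ j (x : p j), e.symm x = DirectSum.lof 𝕜 ι (fun i => p i) j x := fun j x => by
    rw [LinearEquiv.symm_apply_eq]
    exact (DirectSum.coeLinearMap_lof p j x).symm
  refine ⟨(p i).subtype ∘ₗ DirectSum.component 𝕜 ι (fun i => p i) i ∘ₗ e.symm.toLinearMap,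
    fun x hx => ?_, fun j hj x hx => ?_⟩
  · have := he i ⟨x, hx⟩
    simp only [LinearMap.comp_apply, LinearEquiv.coe_coe, this, DirectSum.component.lof_self]
    rfl
  · have := he j ⟨x, hx⟩
    simp only [LinearMap.comp_apply, LinearEquiv.coe_coe, this]
    rw [DirectSum.component.of, dif_neg hj, map_zero]

namespace ZigzagAlg

variable {𝕜 : Type u} [Field 𝕜]

theorem e_mul_e_of_ne {r s : ℤ} (h : r ≠ s) : e 𝕜 r * e 𝕜 s = 0 :=
  Subtype.ext (((map_mul _ _ _).symm.trans
    ((RingQuot.mkAlgHom_rel 𝕜 (.orth r s h)).trans (map_zero _))))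

theorem e_mul_a (r : ℤ) : e 𝕜 r * a 𝕜 r = a 𝕜 r :=
  Subtype.ext (((map_mul _ _ _).symm.trans (RingQuot.mkAlgHom_rel 𝕜 (.a_start r))))

theorem e_mul_b (r : ℤ) : e 𝕜 r * b 𝕜 r = b 𝕜 r :=
  Subtype.ext (((map_mul _ _ _).symm.trans (RingQuot.mkAlgHom_rel 𝕜 (.b_start r))))

/-- The zig-zag algebra is generated by the paths of length at most one. -/
theorem induction_on {p : ZigzagAlg 𝕜 → Prop} (x : ZigzagAlg 𝕜) (he : ∀ r, p (e 𝕜 r))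
    (ha : ∀ r, p (a 𝕜 r)) (hb : ∀ r, p (b 𝕜 r)) (zero : p 0)
    (add : ∀ x y, p x → p y → p (x + y)) (mul : ∀ x y, p x → p y → p (x * y))
    (smul : ∀ (c : 𝕜) x, p x → p (c • x)) : p x := by
  obtain ⟨x, hx⟩ := x
  induction hx using NonUnitalAlgebra.adjoin_induction with
  | mem x h =>
    obtain ⟨g, rfl⟩ := h
    cases g with
    | e r => exact he r
    | a r => exact ha r
    | b r => exact hb r
  | zero => exact zero
  | add x y hx hy h h' => exact add ⟨x, hx⟩ ⟨y, hy⟩ h h'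
  | mul x y hx hy h h' => exact mul ⟨x, hx⟩ ⟨y, hy⟩ h h'
  | smul c x hx h => exact smul c ⟨x, hx⟩ h

end ZigzagAlg

namespace GrMod

variable {𝕜 : Type u} [Field 𝕜]

theorem act_e_of_mem (M : GrMod 𝕜) {r j : ℤ} {m : M.carrier} (hm : m ∈ M.part r j) :
    M.act (ZigzagAlg.e 𝕜 r) m = m := by
  obtain ⟨_, x, rfl⟩ := hm
  rw [← M.act_mul, ZigzagAlg.e_mul_e]

theorem act_e_of_ne (M : GrMod 𝕜) {r s j : ℤ} (h : r ≠ s) {m : M.carrier} (hm : m ∈ M.part r j) :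
    M.act (ZigzagAlg.e 𝕜 s) m = 0 := by
  obtain ⟨_, x, rfl⟩ := hm
  rw [← M.act_mul, ZigzagAlg.e_mul_e_of_ne h]
  simp

theorem act_a_of_ne (M : GrMod 𝕜) {r s j : ℤ} (h : r ≠ s) {m : M.carrier} (hm : m ∈ M.part r j) :
    M.act (ZigzagAlg.a 𝕜 s) m = 0 := by
  rw [← ZigzagAlg.e_mul_a, M.act_mul, M.act_e_of_ne h hm, map_zero]

theorem act_b_of_ne (M : GrMod 𝕜) {r s j : ℤ} (h : r ≠ s) {m : M.carrier} (hm : m ∈ M.part r j) :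
    M.act (ZigzagAlg.b 𝕜 s) m = 0 := by
  rw [← ZigzagAlg.e_mul_b, M.act_mul, M.act_e_of_ne h hm, map_zero]

theorem act_e_mem_gr (M : GrMod 𝕜) (r : ℤ) {j : ℤ} {m : M.carrier} (hm : m ∈ M.gr j) :
    M.act (ZigzagAlg.e 𝕜 r) m ∈ M.gr j := by
  simpa using M.act_mem (.e r) hm

theorem iSup_part (M : GrMod 𝕜) : ⨆ p : ℤ × ℤ, M.part (p.1 - p.2) p.2 = ⊤ := by
  rw [eq_top_iff, ← M.iSup_range]
  refine iSup_le fun r => ?_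
  rw [LinearMap.range_eq_map, ← M.isInternal.submodule_iSup_eq_top, Submodule.map_iSup]
  refine iSup_le fun j => ?_
  rintro _ ⟨x, hx, rfl⟩
  refine Submodule.mem_iSup_of_mem (r + j, j) ?_
  rw [add_sub_cancel_right]
  exact ⟨M.act_e_mem_gr r hx, x, rfl⟩

theorem isInternal_part (M : GrMod 𝕜) :
    DirectSum.IsInternal fun p : ℤ × ℤ => M.part (p.1 - p.2) p.2 := by
  rw [DirectSum.isInternal_submodule_iff_iSupIndep_and_iSup_eq_top]
  refine ⟨?_, M.iSup_part⟩
  choose P hP₁ hP₂ using fun j => M.isInternal.exists_projection j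
  refine iSupIndep_of_projections _
    (fun p => P p.2 ∘ₗ M.act (ZigzagAlg.e 𝕜 (p.1 - p.2))) ?_ ?_
  · intro p x hx
    rw [LinearMap.comp_apply, M.act_e_of_mem hx, hP₁ _ _ hx.1]
  · rintro p q hpq x hx
    rw [LinearMap.comp_apply]
    by_cases h : q.2 = p.2
    · rw [M.act_e_of_ne (fun h' => hpq (Prod.ext (by omega) h)) hx, map_zero]
    · exact hP₂ _ _ h _ (M.act_e_mem_gr _ hx.1)

theorem linearMap_ext (M : GrMod 𝕜) {V : Type*} [AddCommGroup V] [Module 𝕜 V]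
    {f g : M.carrier →ₗ[𝕜] V} (h : ∀ i j, ∀ x ∈ M.part (i - j) j, f x = g x) : f = g := by
  rw [← LinearMap.eqLocus_eq_top, eq_top_iff, ← M.iSup_part]
  exact iSup_le fun p x hx => h p.1 p.2 x hx

/-- A linear map can be prescribed on the homogeneous parts. -/
theorem exists_linearMap (M : GrMod 𝕜) {V : Type*} [AddCommGroup V] [Module 𝕜 V]
    (φ : ∀ i j, M.part (i - j) j →ₗ[𝕜] V) :
    ∃ f : M.carrier →ₗ[𝕜] V, ∀ i j (x : M.part (i - j) j), f x = φ i j x := by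
  have hinj : Function.Bijective
    (DirectSum.coeLinearMap fun p : ℤ × ℤ => M.part (p.1 - p.2) p.2) := M.isInternal_part
  let e := LinearEquiv.ofBijective _ hinj
  refine ⟨DirectSum.toModule 𝕜 (ℤ × ℤ) V (fun p => φ p.1 p.2) ∘ₗ e.symm.toLinearMap,
    fun i j x => ?_⟩
  have he : e.symm x =
      DirectSum.lof 𝕜 (ℤ × ℤ) (fun p => M.part (p.1 - p.2) p.2) (i, j) x := by
    rw [LinearEquiv.symm_apply_eq]
    exact (DirectSum.coeLinearMap_lof (fun p : ℤ × ℤ => M.part (p.1 - p.2) p.2)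
      (i, j) x).symm
  rw [LinearMap.comp_apply, LinearEquiv.coe_coe, he, DirectSum.toModule_lof]

theorem gr_le_iSup_part (M : GrMod 𝕜) (j : ℤ) : M.gr j ≤ ⨆ i, M.part (i - j) j := by
  obtain ⟨P, hP₁, hP₂⟩ := M.isInternal.exists_projection j
  intro m hm
  rw [← hP₁ m hm]
  have h : (⊤ : Submodule 𝕜 M.carrier) ≤ (⨆ i, M.part (i - j) j).comap P := by
    rw [← M.iSup_part]
    refine iSup_le fun p x hx => ?_
    by_cases h : p.2 = j
    · subst h
      rw [Submodule.mem_comap, hP₁ x hx.1]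
      exact Submodule.mem_iSup_of_mem p.1 hx
    · rw [Submodule.mem_comap, hP₂ _ h _ hx.1]
      exact zero_mem _
  exact h trivial

theorem epi_of_surjective {M N : GrMod 𝕜} (f : M ⟶ N) (hf : Function.Surjective f.lin) : Epi f where
  left_cancellation g h e := by
    ext y
    obtain ⟨x, rfl⟩ := hf y
    exact congrArg (fun t : M ⟶ _ => t.lin x) e

end GrMod

namespace GInf

variable {𝕜 : Type u} [Field 𝕜]

instance faithful : (GInf 𝕜).Faithful where
  map_injective {M N f g} h := by
    ext k x
    refine LinearMap.congr_fun (GrMod.linearMap_ext _ fun i j x hx => ?_) x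
    exact congrArg (fun t : obj M ⟶ obj N => (t.app i j k ⟨x, hx⟩).1) h

section Full

variable {M N : CochainComplex (GrMod 𝕜) ℤ} (g : obj M ⟶ obj N)

/-- `f` restricts to the components of `g` in degree `k`. -/
def Restricts (k : ℤ) (f : (M.X k).carrier →ₗ[𝕜] (N.X k).carrier) : Prop :=
  ∀ i j (x : (M.X k).part (i - j) j), f x = (g.app i j k x).1

theorem exists_restricts (k : ℤ) : ∃ f, Restricts g k f :=
  (M.X k).exists_linearMap fun i j => ((N.X k).part (i - j) j).subtype ∘ₗ g.app i j k

variable {g} {k : ℤ} {f : (M.X k).carrier →ₗ[𝕜] (N.X k).carrier}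

theorem Restricts.act_e (hf : Restricts g k f) {s i j : ℤ} (x : (M.X k).part (i - j) j) :
    f ((M.X k).act (ZigzagAlg.e 𝕜 s) x) = (N.X k).act (ZigzagAlg.e 𝕜 s) (f x) := by
  rw [hf]
  by_cases h : i - j = s
  · subst h
    rw [GrMod.act_e_of_mem _ x.2, GrMod.act_e_of_mem _ (g.app i j k x).2, hf]
  · rw [GrMod.act_e_of_ne _ h x.2, GrMod.act_e_of_ne _ h (g.app i j k x).2, map_zero]

theorem Restricts.act_a (hf : Restricts g k f) {s i j : ℤ} (x : (M.X k).part (i - j) j) :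
    f ((M.X k).act (ZigzagAlg.a 𝕜 s) x) = (N.X k).act (ZigzagAlg.a 𝕜 s) (f x) := by
  rw [hf]
  by_cases h : i - j = s
  · subst h
    exact (hf _ _ (d1 M j k rfl x)).trans (congrArg Subtype.val (g.comm1 j k rfl x))
  · rw [GrMod.act_a_of_ne _ h x.2, GrMod.act_a_of_ne _ h (g.app i j k x).2, map_zero]

theorem Restricts.act_b (hf : Restricts g k f) {s i j : ℤ} (x : (M.X k).part (i - j) j) :
    f ((M.X k).act (ZigzagAlg.b 𝕜 s) x) = (N.X k).act (ZigzagAlg.b 𝕜 s) (f x) := by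
  rw [hf]
  by_cases h : i - j = s
  · subst h
    have h₁ := (hf _ _ (d2 M i k rfl x)).trans (congrArg Subtype.val (g.comm2 i k rfl x))
    exact smul_left_cancel (i - j).negOnePow ((map_zsmul f _ _).symm.trans h₁)
  · rw [GrMod.act_b_of_ne _ h x.2, GrMod.act_b_of_ne _ h (g.app i j k x).2, map_zero]

theorem Restricts.map_act (hf : Restricts g k f) (x : ZigzagAlg 𝕜) (m : (M.X k).carrier) :
    f ((M.X k).act x m) = (N.X k).act x (f m) := by
  induction x using ZigzagAlg.induction_on generalizing m with
  | he s =>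
    exact LinearMap.congr_fun ((M.X k).linearMap_ext (f := f ∘ₗ (M.X k).act _)
      (g := (N.X k).act _ ∘ₗ f) fun i j x hx => hf.act_e ⟨x, hx⟩) m
  | ha s =>
    exact LinearMap.congr_fun ((M.X k).linearMap_ext (f := f ∘ₗ (M.X k).act _)
      (g := (N.X k).act _ ∘ₗ f) fun i j x hx => hf.act_a ⟨x, hx⟩) m
  | hb s =>
    exact LinearMap.congr_fun ((M.X k).linearMap_ext (f := f ∘ₗ (M.X k).act _)
      (g := (N.X k).act _ ∘ₗ f) fun i j x hx => hf.act_b ⟨x, hx⟩) m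
  | zero => simp
  | add x y hx hy => simp [hx, hy]
  | mul x y hx hy => rw [GrMod.act_mul, GrMod.act_mul, hy, hx]
  | smul c x hx => simp [hx]

theorem Restricts.map_gr (hf : Restricts g k f) {j : ℤ} {m : (M.X k).carrier}
    (hm : m ∈ (M.X k).gr j) : f m ∈ (N.X k).gr j := by
  have h : ⨆ i, (M.X k).part (i - j) j ≤ ((N.X k).gr j).comap f := iSup_le fun i x hx => by
    rw [Submodule.mem_comap, hf i j ⟨x, hx⟩]
    exact (g.app i j k ⟨x, hx⟩).2.1
  exact h ((M.X k).gr_le_iSup_part j hm)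

theorem Restricts.comm (hf : Restricts g k f) {k' : ℤ}
    {f' : (M.X k').carrier →ₗ[𝕜] (N.X k').carrier} (hf' : Restricts g k' f') (h : k + 1 = k')
    (m : (M.X k).carrier) : f' ((M.d k k').lin m) = (N.d k k').lin (f m) := by
  refine LinearMap.congr_fun ((M.X k).linearMap_ext (f := f' ∘ₗ (M.d k k').lin)
    (g := (N.d k k').lin ∘ₗ f) fun i j x hx => ?_) m
  have h₁ := (hf' _ _ (d3 M i j h ⟨x, hx⟩)).trans (congrArg Subtype.val (g.comm3 i j h ⟨x, hx⟩))
  refine (smul_left_cancel (i - j + k).negOnePow ((map_zsmul f' _ _).symm.trans h₁)).trans ?_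
  exact congrArg _ (hf i j ⟨x, hx⟩).symm

instance full : (GInf 𝕜).Full where
  map_surjective {M N} g := by
    choose f hf using exists_restricts (M := M) (N := N) g
    refine ⟨{ f := fun k => ⟨f k, (hf k).map_act, (hf k).map_gr⟩, comm' := ?_ }, ?_⟩
    · rintro k k' h
      ext m
      exact ((hf k).comm (hf k') h m).symm
    · ext i j k x
      exact Subtype.ext (hf k i j x)

end Full

end GInf

namespace TriMod

variable {𝕜 : Type u} [Field 𝕜]

theorem isIso_of_bijective {M N : TriMod 𝕜} (f : M ⟶ N)
    (hf : ∀ i j k, Function.Bijective (f.app i j k)) : IsIso f := by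
  let e := fun i j k => LinearEquiv.ofBijective (f.app i j k) (hf i j k)
  have he : ∀ i j k x, f.app i j k ((e i j k).symm x) = x := fun i j k x =>
    (e i j k).apply_symm_apply x
  have he' : ∀ i j k x, (e i j k).symm (f.app i j k x) = x := fun i j k x =>
    (e i j k).symm_apply_apply x
  refine ⟨⟨fun i j k => (e i j k).symm.toLinearMap, fun {i i'} j k h x => (hf _ _ _).1 ?_,
    fun i {j j'} k h x => (hf _ _ _).1 ?_, fun i j {k k'} h x => (hf _ _ _).1 ?_⟩, ?_, ?_⟩
  · simp [f.comm1, he]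
  · simp [f.comm2, he]
  · simp [f.comm3, he]
  · ext i j k x
    exact he' i j k x
  · ext i j k x
    exact he i j k x

/-! ### The complex of graded modules attached to a trigraded module -/

section Total

variable (T : TriMod 𝕜)

/-- The direct sum of the components `T.X i j k` for a fixed `k`. -/
abbrev Total (k : ℤ) : Type u := DirectSum (ℤ × ℤ) fun p => T.X p.1 p.2 k

/-- The inclusion of a component. -/
abbrev incl (i j k : ℤ) : T.X i j k →ₗ[𝕜] T.Total k :=
  DirectSum.lof 𝕜 (ℤ × ℤ) (fun p => T.X p.1 p.2 k) (i, j)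

variable {T} in
theorem total_ext {k : ℤ} {V : Type*} [AddCommGroup V] [Module 𝕜 V] {f g : T.Total k →ₗ[𝕜] V}
    (h : ∀ i j x, f (T.incl i j k x) = g (T.incl i j k x)) : f = g :=
  DirectSum.linearMap_ext _ fun p => LinearMap.ext fun x => h p.1 p.2 x

theorem incl_injective (i j k : ℤ) : Function.Injective (T.incl i j k) :=
  DirectSum.of_injective (β := fun p : ℤ × ℤ => T.X p.1 p.2 k) (i, j)

/-- The operator on `Total` of a path of length at most one. -/
def genAct (k : ℤ) : ZigzagGen → Module.End 𝕜 (T.Total k)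
  | .e r => DirectSum.toModule 𝕜 _ _ fun p => if p.1 - p.2 = r then T.incl p.1 p.2 k else 0
  | .a r => DirectSum.toModule 𝕜 _ _ fun p =>
      if p.1 - p.2 = r then T.incl (p.1 + 1) p.2 k ∘ₗ T.d1 p.2 k rfl else 0
  | .b r => DirectSum.toModule 𝕜 _ _ fun p =>
      if p.1 - p.2 = r then r.negOnePow • (T.incl p.1 (p.2 + 1) k ∘ₗ T.d2 p.1 k rfl) else 0

/-- The projection of `Total` to the part of degree `j`. -/
def grProj (k j : ℤ) : Module.End 𝕜 (T.Total k) :=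
  DirectSum.toModule 𝕜 _ _ fun p => if p.2 = j then T.incl p.1 p.2 k else 0

/-- The differential of the total complex. -/
def totalD (k k' : ℤ) (h : k + 1 = k') : T.Total k →ₗ[𝕜] T.Total k' :=
  DirectSum.toModule 𝕜 _ _ fun p =>
    (p.1 - p.2 + k).negOnePow • (T.incl p.1 p.2 k' ∘ₗ T.d3 p.1 p.2 h)

theorem genAct_e (r i j k : ℤ) (x : T.X i j k) : T.genAct k (.e r) (T.incl i j k x) =
    if i - j = r then T.incl i j k x else 0 := by
  rw [genAct, DirectSum.toModule_lof]
  split_ifs <;> rfl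

theorem genAct_a (r i j k : ℤ) (x : T.X i j k) : T.genAct k (.a r) (T.incl i j k x) =
    if i - j = r then T.incl (i + 1) j k (T.d1 j k rfl x) else 0 := by
  rw [genAct, DirectSum.toModule_lof]
  split_ifs <;> rfl

theorem genAct_b (r i j k : ℤ) (x : T.X i j k) : T.genAct k (.b r) (T.incl i j k x) =
    if i - j = r then r.negOnePow • T.incl i (j + 1) k (T.d2 i k rfl x) else 0 := by
  rw [genAct, DirectSum.toModule_lof]
  split_ifs <;> rfl

theorem grProj_incl (k j' i j : ℤ) (x : T.X i j k) : T.grProj k j' (T.incl i j k x) =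
    if j = j' then T.incl i j k x else 0 := by
  rw [grProj, DirectSum.toModule_lof]
  split_ifs <;> rfl

theorem totalD_incl {k k' : ℤ} (h : k + 1 = k') (i j : ℤ) (x : T.X i j k) :
    T.totalD k k' h (T.incl i j k x) = (i - j + k).negOnePow • T.incl i j k' (T.d3 i j h x) := by
  rw [totalD, DirectSum.toModule_lof]
  rfl

/-- The action of the free algebra; a product acts by its factors from left to right. -/
def freeAct (k : ℤ) : FreeAlgebra 𝕜 ZigzagGen →ₐ[𝕜] (Module.End 𝕜 (T.Total k))ᵐᵒᵖ :=
  FreeAlgebra.lift 𝕜 fun g => MulOpposite.op (T.genAct k g)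

theorem freeAct_rel (k : ℤ) ⦃x y : FreeAlgebra 𝕜 ZigzagGen⦄ (h : ZigzagRel 𝕜 x y) :
    T.freeAct k x = T.freeAct k y := by
  have key : ∀ g, T.freeAct k (FreeAlgebra.ι 𝕜 g) = MulOpposite.op (T.genAct k g) :=
    fun g => FreeAlgebra.lift_ι_apply _ _
  have zs : ∀ (n : ℤˣ) (f : Module.End 𝕜 (T.Total k)) x, f (n • x) = n • f x :=
    fun n f x => map_zsmul f _ _
  induction h with
  | idem r =>
    rw [map_mul, key, ← MulOpposite.op_mul]
    refine congrArg MulOpposite.op (total_ext fun i j x => ?_)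
    rw [Module.End.mul_apply, genAct_e]
    split_ifs with h
    · rw [genAct_e, if_pos h]
    · rw [map_zero]
  | orth r s hrs =>
    rw [map_mul, key, key, ← MulOpposite.op_mul, map_zero, ← MulOpposite.op_zero]
    refine congrArg MulOpposite.op (total_ext fun i j x => ?_)
    rw [Module.End.mul_apply, genAct_e]
    split_ifs with h
    · rw [genAct_e, if_neg (by omega)]; rfl
    · rw [map_zero]; rfl
  | a_start r =>
    rw [map_mul, key, key, ← MulOpposite.op_mul]
    refine congrArg MulOpposite.op (total_ext fun i j x => ?_)
    rw [Module.End.mul_apply, genAct_e]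
    split_ifs with h
    · rfl
    · rw [map_zero, genAct_a, if_neg h]
  | a_end r =>
    rw [map_mul, key, key, ← MulOpposite.op_mul]
    refine congrArg MulOpposite.op (total_ext fun i j x => ?_)
    rw [Module.End.mul_apply, genAct_a]
    split_ifs with h
    · rw [genAct_e, if_pos (by omega)]
    · rw [map_zero]
  | b_start r =>
    rw [map_mul, key, key, ← MulOpposite.op_mul]
    refine congrArg MulOpposite.op (total_ext fun i j x => ?_)
    rw [Module.End.mul_apply, genAct_e]
    split_ifs with h
    · rfl
    · rw [map_zero, genAct_b, if_neg h]
  | b_end r =>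
    rw [map_mul, key, key, ← MulOpposite.op_mul]
    refine congrArg MulOpposite.op (total_ext fun i j x => ?_)
    rw [Module.End.mul_apply, genAct_b]
    split_ifs with h
    · rw [zs, genAct_e, if_pos (by omega)]
    · rw [map_zero]
  | a_a r =>
    rw [map_mul, key, key, ← MulOpposite.op_mul, map_zero, ← MulOpposite.op_zero]
    refine congrArg MulOpposite.op (total_ext fun i j x => ?_)
    rw [Module.End.mul_apply, genAct_a]
    split_ifs with h
    · rw [genAct_a, if_pos (by omega), T.d1_d1, map_zero]; rfl
    · rw [map_zero]; rfl
  | b_b r =>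
    rw [map_mul, key, key, ← MulOpposite.op_mul, map_zero, ← MulOpposite.op_zero]
    refine congrArg MulOpposite.op (total_ext fun i j x => ?_)
    rw [Module.End.mul_apply, genAct_b]
    split_ifs with h
    · rw [zs, genAct_b, if_pos (by omega), T.d2_d2, map_zero, smul_zero, smul_zero]; rfl
    · rw [map_zero]; rfl
  | loop r =>
    rw [map_mul, map_mul, key, key, key, key, ← MulOpposite.op_mul, ← MulOpposite.op_mul]
    refine congrArg MulOpposite.op (total_ext fun i j x => ?_)
    rw [Module.End.mul_apply, Module.End.mul_apply, genAct_b, genAct_a]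
    split_ifs with h
    · rw [zs, genAct_a, if_pos (by omega), genAct_b, if_pos (by omega),
        eq_neg_of_add_eq_zero_left (T.d1_d2 k rfl rfl x), Int.negOnePow_succ, map_neg,
        smul_neg, Units.neg_smul]
    · rw [map_zero, map_zero]

/-- The action of the unitization of the zig-zag algebra. -/
def ringAct (k : ℤ) : RingQuot (ZigzagRel 𝕜) →ₐ[𝕜] (Module.End 𝕜 (T.Total k))ᵐᵒᵖ :=
  RingQuot.liftAlgHom 𝕜 ⟨T.freeAct k, T.freeAct_rel k⟩

/-- The action of the zig-zag algebra. -/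
def totalAct (k : ℤ) : ZigzagAlg 𝕜 →ₗ[𝕜] Module.End 𝕜 (T.Total k) :=
  (MulOpposite.opLinearEquiv 𝕜).symm.toLinearMap ∘ₗ (T.ringAct k).toLinearMap ∘ₗ
    (ZigzagAlg 𝕜).toSubmodule.subtype

theorem totalAct_of (k : ℤ) (g : ZigzagGen) : T.totalAct k (ZigzagAlg.of 𝕜 g) = T.genAct k g := by
  change MulOpposite.unop (T.ringAct k (RingQuot.mkAlgHom 𝕜 _ (FreeAlgebra.ι 𝕜 g))) = _
  rw [ringAct, RingQuot.liftAlgHom_mkAlgHom_apply, freeAct, FreeAlgebra.lift_ι_apply]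
  rfl

theorem totalAct_mul (k : ℤ) (x y : ZigzagAlg 𝕜) (m : T.Total k) :
    T.totalAct k (x * y) m = T.totalAct k y (T.totalAct k x m) := by
  change MulOpposite.unop (T.ringAct k (x.1 * y.1)) m = _
  rw [map_mul]
  rfl

/-- The grading of `Total` by `j`. -/
def totalGr (k j : ℤ) : Submodule 𝕜 (T.Total k) := ⨆ i, LinearMap.range (T.incl i j k)

variable {T} in
theorem incl_mem_totalGr {i j k : ℤ} (x : T.X i j k) : T.incl i j k x ∈ T.totalGr k j :=
  Submodule.mem_iSup_of_mem i ⟨x, rfl⟩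

variable {T} in
theorem map_mem_totalGr {k j : ℤ} {V : Type*} [AddCommGroup V] [Module 𝕜 V] {p : Submodule 𝕜 V}
    {f : T.Total k →ₗ[𝕜] V} (h : ∀ i x, f (T.incl i j k x) ∈ p) {m : T.Total k}
    (hm : m ∈ T.totalGr k j) : f m ∈ p := by
  have : T.totalGr k j ≤ p.comap f := iSup_le fun i => by
    rintro _ ⟨x, rfl⟩
    exact h i x
  exact this hm

theorem grProj_of_mem {k j : ℤ} {m : T.Total k} (hm : m ∈ T.totalGr k j) :
    T.grProj k j m = m := by
  have h : (T.grProj k j - LinearMap.id : Module.End 𝕜 (T.Total k)) m ∈ (⊥ : Submodule 𝕜 (T.Total k)) :=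
    map_mem_totalGr (fun i x => by
      rw [LinearMap.sub_apply, grProj_incl, if_pos rfl]; simp) hm
  rw [Submodule.mem_bot, LinearMap.sub_apply, sub_eq_zero] at h
  exact h

theorem totalGr_isInternal (k : ℤ) : DirectSum.IsInternal (T.totalGr k) := by
  rw [DirectSum.isInternal_submodule_iff_iSupIndep_and_iSup_eq_top]
  constructor
  · refine iSupIndep_of_projections _ (T.grProj k) (fun j x hx => T.grProj_of_mem hx)
      fun j j' hj x hx => (Submodule.mem_bot 𝕜).1 (map_mem_totalGr (fun i x => ?_) hx)
    rw [grProj_incl, if_neg hj]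
    exact zero_mem _
  · rw [eq_top_iff]
    intro m _
    induction m using DirectSum.induction_on with
    | zero => exact zero_mem _
    | of p x => exact Submodule.mem_iSup_of_mem p.2 (incl_mem_totalGr (i := p.1) x)
    | add x y hx hy => exact add_mem (hx trivial) (hy trivial)

theorem totalAct_mem {k : ℤ} {x : ZigzagAlg 𝕜} {d : ℤ} (hx : ZigzagAlg.HasDegree x d) {j : ℤ}
    {m : T.Total k} (hm : m ∈ T.totalGr k j) : T.totalAct k x m ∈ T.totalGr k (j + d) := by
  induction hx generalizing j m with
  | e r =>
    refine map_mem_totalGr (fun i x => ?_) hm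
    rw [ZigzagAlg.e, totalAct_of, genAct_e, add_zero]
    split_ifs
    exacts [incl_mem_totalGr x, zero_mem _]
  | a r =>
    refine map_mem_totalGr (fun i x => ?_) hm
    rw [ZigzagAlg.a, totalAct_of, genAct_a, add_zero]
    split_ifs
    exacts [incl_mem_totalGr _, zero_mem _]
  | b r =>
    refine map_mem_totalGr (fun i x => ?_) hm
    rw [ZigzagAlg.b, totalAct_of, genAct_b]
    split_ifs
    · rw [Units.smul_def]
      exact zsmul_mem (incl_mem_totalGr _) _
    · exact zero_mem _
  | mul _ _ hx hy =>
    rw [totalAct_mul, ← add_assoc]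
    exact hy (hx hm)
  | zero d => simp
  | add _ _ hx hy =>
    rw [map_add]
    exact add_mem (hx hm) (hy hm)
  | smul c _ hx =>
    rw [map_smul]
    exact Submodule.smul_mem _ c (hx hm)

/-- The graded module `⨁ T.X i j k` over the zig-zag algebra. -/
def toGrMod (k : ℤ) : GrMod 𝕜 where
  carrier := T.Total k
  act := T.totalAct k
  act_mul := T.totalAct_mul k
  gr := T.totalGr k
  isInternal := T.totalGr_isInternal k
  act_mem := T.totalAct_mem
  iSup_range := by
    rw [eq_top_iff]
    intro m _
    induction m using DirectSum.induction_on with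
    | zero => exact zero_mem _
    | of p x =>
      refine Submodule.mem_iSup_of_mem (p.1 - p.2) ⟨T.incl p.1 p.2 k x, ?_⟩
      rw [ZigzagAlg.e, totalAct_of, genAct_e, if_pos rfl]
      rfl
    | add x y hx hy => exact add_mem (hx trivial) (hy trivial)

theorem totalD_act {k k' : ℤ} (h : k + 1 = k') (x : ZigzagAlg 𝕜) (m : T.Total k) :
    T.totalD k k' h (T.totalAct k x m) = T.totalAct k' x (T.totalD k k' h m) := by
  have zs : ∀ (n : ℤˣ) {k k' : ℤ} (f : T.Total k →ₗ[𝕜] T.Total k') x, f (n • x) = n • f x :=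
    fun n _ _ f x => map_zsmul f _ _
  induction x using ZigzagAlg.induction_on generalizing m with
  | he s =>
    refine LinearMap.congr_fun (total_ext (f := T.totalD k k' h ∘ₗ T.totalAct k _)
      (g := T.totalAct k' _ ∘ₗ T.totalD k k' h) fun i j x => ?_) m
    rw [LinearMap.comp_apply, LinearMap.comp_apply, ZigzagAlg.e, totalAct_of, totalAct_of,
      genAct_e, totalD_incl, zs, genAct_e]
    split_ifs
    · rw [totalD_incl]
    · rw [map_zero, smul_zero]
  | ha s =>
    refine LinearMap.congr_fun (total_ext (f := T.totalD k k' h ∘ₗ T.totalAct k _)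
      (g := T.totalAct k' _ ∘ₗ T.totalD k k' h) fun i j x => ?_) m
    rw [LinearMap.comp_apply, LinearMap.comp_apply, ZigzagAlg.a, totalAct_of, totalAct_of,
      genAct_a, totalD_incl, zs, genAct_a]
    split_ifs
    · rw [totalD_incl, eq_neg_of_add_eq_zero_left (T.d1_d3 j rfl h x), map_neg, smul_neg,
        show i + 1 - j + k = i - j + k + 1 by ring, Int.negOnePow_succ, Units.neg_smul]
    · rw [map_zero, smul_zero]
  | hb s =>
    refine LinearMap.congr_fun (total_ext (f := T.totalD k k' h ∘ₗ T.totalAct k _)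
      (g := T.totalAct k' _ ∘ₗ T.totalD k k' h) fun i j x => ?_) m
    rw [LinearMap.comp_apply, LinearMap.comp_apply, ZigzagAlg.b, totalAct_of, totalAct_of,
      genAct_b, totalD_incl, zs, genAct_b]
    split_ifs
    · rw [zs, totalD_incl, eq_neg_of_add_eq_zero_left (T.d2_d3 i rfl h x), map_neg, smul_neg,
        show i - j + k = i - (j + 1) + k + 1 by ring, Int.negOnePow_succ, Units.neg_smul, smul_neg,
        neg_neg, smul_comm]
    · rw [map_zero, smul_zero]
  | zero => simp
  | add x y hx hy => simp [hx, hy]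
  | mul x y hx hy => rw [totalAct_mul, totalAct_mul, hy, hx]
  | smul c x hx => simp [hx]

/-- The differential of the total complex as a morphism of graded modules. -/
def toGrModD (k k' : ℤ) (h : k + 1 = k') : T.toGrMod k ⟶ T.toGrMod k' where
  lin := T.totalD k k' h
  map_act := T.totalD_act h
  map_gr {j m} hm := map_mem_totalGr (p := T.totalGr k' j) (fun i x => by
    rw [totalD_incl, Units.smul_def]
    exact zsmul_mem (incl_mem_totalGr _) _) hm

/-- The complex of graded modules attached to a trigraded module. -/
def toComplex : CochainComplex (GrMod 𝕜) ℤ where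
  X := T.toGrMod
  d k k' := if h : k + 1 = k' then T.toGrModD k k' h else 0
  shape k k' h := dif_neg h
  d_comp_d' k k' k'' h h' := by
    have zs : ∀ (n : ℤˣ) {k k' : ℤ} (f : T.Total k →ₗ[𝕜] T.Total k') x, f (n • x) = n • f x :=
      fun n _ _ f x => map_zsmul f _ _
    change k + 1 = k' at h
    change k' + 1 = k'' at h'
    rw [dif_pos h, dif_pos h']
    ext m
    refine LinearMap.congr_fun (total_ext (f := T.totalD k' k'' h' ∘ₗ T.totalD k k' h)
      (g := 0) fun i j x => ?_) m
    rw [LinearMap.comp_apply, totalD_incl, zs, totalD_incl, T.d3_d3, map_zero, smul_zero, smul_zero]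
    rfl

theorem incl_mem_part (i j k : ℤ) (x : T.X i j k) :
    T.incl i j k x ∈ (T.toGrMod k).part (i - j) j := by
  refine ⟨incl_mem_totalGr x, T.incl i j k x, ?_⟩
  change T.totalAct k _ _ = _
  rw [ZigzagAlg.e, totalAct_of, genAct_e, if_pos rfl]

theorem exists_of_mem_part {i j k : ℤ} {m : T.Total k} (hm : m ∈ (T.toGrMod k).part (i - j) j) :
    ∃ x, T.incl i j k x = m := by
  have h₁ : T.genAct k (.e (i - j)) m = m := by
    rw [← totalAct_of]
    exact GrMod.act_e_of_mem _ hm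
  have h₂ : T.grProj k j m = m := T.grProj_of_mem hm.1
  have h : LinearMap.range (T.grProj k j ∘ₗ T.genAct k (.e (i - j))) ≤
      LinearMap.range (T.incl i j k) := by
    rintro _ ⟨y, rfl⟩
    induction y using DirectSum.induction_on with
    | zero => rw [map_zero]; exact zero_mem _
    | of p x =>
      change (T.grProj k j ∘ₗ T.genAct k (.e (i - j))) (T.incl p.1 p.2 k x) ∈ _
      rw [LinearMap.comp_apply, genAct_e]
      split_ifs with hp
      · rw [grProj_incl]
        split_ifs with hp'
        · obtain ⟨p₁, p₂⟩ := p
          obtain rfl : p₂ = j := hp'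
          obtain rfl : p₁ = i := by simpa using hp
          exact ⟨x, rfl⟩
        · exact zero_mem _
      · rw [map_zero]; exact zero_mem _
    | add x y hx hy => rw [map_add]; exact add_mem hx hy
  exact h ⟨m, by rw [LinearMap.comp_apply, h₁, h₂]⟩

/-- The comparison of `T` with the trigraded module of its complex. -/
def toGInf : T ⟶ GInf.obj T.toComplex where
  app i j k := (T.incl i j k).codRestrict ((T.toGrMod k).part (i - j) j) (T.incl_mem_part i j k)
  comm1 {i i'} j k h x := by
    subst h
    refine Subtype.ext ?_
    change T.incl (i + 1) j k _ = T.totalAct k (ZigzagAlg.a 𝕜 (i - j)) (T.incl i j k x)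
    rw [ZigzagAlg.a, totalAct_of, genAct_a, if_pos rfl]
  comm2 i {j j'} k h x := by
    subst h
    refine Subtype.ext ?_
    change T.incl i (j + 1) k _ =
      (i - j).negOnePow • T.totalAct k (ZigzagAlg.b 𝕜 (i - j)) (T.incl i j k x)
    rw [ZigzagAlg.b, totalAct_of, genAct_b, if_pos rfl, smul_smul, Int.units_mul_self, one_smul]
  comm3 i j {k k'} h x := by
    refine Subtype.ext ?_
    change T.incl i j k' _ = (i - j + k).negOnePow • (T.toComplex.d k k').lin (T.incl i j k x)
    have hd : T.toComplex.d k k' = T.toGrModD k k' h := dif_pos h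
    rw [hd]
    change _ = (i - j + k).negOnePow • T.totalD k k' h (T.incl i j k x)
    rw [totalD_incl, smul_smul, Int.units_mul_self, one_smul]

instance : IsIso T.toGInf :=
  isIso_of_bijective _ fun i j k =>
    ⟨fun _ _ h => T.incl_injective i j k (congrArg Subtype.val h), fun y => by
      obtain ⟨x, hx⟩ := T.exists_of_mem_part y.2
      exact ⟨x, Subtype.ext hx⟩⟩

end Total

end TriMod

instance GInf.essSurj (𝕜 : Type u) [Field 𝕜] : (GInf 𝕜).EssSurj where
  mem_essImage T := ⟨T.toComplex, ⟨(asIso T.toGInf).symm⟩⟩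

instance GInf.isEquivalence (𝕜 : Type u) [Field 𝕜] : (GInf 𝕜).IsEquivalence where

namespace CochainComplex.mappingCone

open HomComplex ZeroObject

variable {C : Type*} [Category* C] [Preadditive C] [HasBinaryBiproducts C]
  {K L : CochainComplex C ℤ} (f : K ⟶ L)

/-- The mapping cone of `f` is the pushout of the cone of the identity along `f`. -/
theorem isPushout_map : IsPushout f (inr (𝟙 K)) (inr f) (map (𝟙 K) f (𝟙 K) f (by simp)) where
  w := by simp [map]
  isColimit' := ⟨PushoutCocone.IsColimit.mk _
    (fun s => desc f ((inl (𝟙 K)).comp (Cochain.ofHom s.inr) (add_zero _)) s.inl (by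
      simp [s.condition]))
    (fun s => by simp)
    (fun s => by
      ext n
      have h := congrArg (fun t => HomologicalComplex.Hom.f t n) s.condition
      rw [ext_from_iff _ (n + 1) n rfl]
      constructor
      · simp [map]
      · simpa [map] using h)
    (fun s m h₁ h₂ => by
      ext n
      rw [ext_from_iff _ (n + 1) n rfl]
      constructor
      · simp [← h₂, map]
      · simp [← h₁])⟩

/-- The connecting morphism of the standard triangle of `f`. -/
noncomputable def connecting : mappingCone f ⟶ K⟦(1 : ℤ)⟧ := (triangle f).mor₃

theorem inr_connecting : inr f ≫ connecting f = 0 := inr_triangleδ f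

theorem inr_f_connecting_f (n : ℤ) : (inr f).f n ≫ (connecting f).f n = 0 :=
  congrArg (fun t => HomologicalComplex.Hom.f t n) (inr_connecting f)

theorem inl_v_connecting_f (n : ℤ) : (inl f).v (n + 1) n (by lia) ≫ (connecting f).f n =
    -(K.shiftFunctorObjXIso 1 n (n + 1) rfl).inv :=
  inl_v_triangle_mor₃_f f (n + 1) n (by lia)

instance epi_connecting_f (n : ℤ) : Epi ((connecting f).f n) :=
  epi_of_epi_fac (f := -(inl f).v (n + 1) n (by lia))
    (h := (K.shiftFunctorObjXIso 1 n (n + 1) rfl).inv) (by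
      rw [Preadditive.neg_comp, inl_v_connecting_f, neg_neg])

instance epi_connecting : Epi (connecting f) where
  left_cancellation g h e := by
    ext n
    rw [← cancel_epi ((connecting f).f n)]
    exact congrArg (fun t => HomologicalComplex.Hom.f t n) e

theorem map_connecting {K' L' : CochainComplex C ℤ} (f' : K' ⟶ L') (a : K ⟶ K') (b : L ⟶ L')
    (comm : f ≫ b = a ≫ f') :
    map f f' a b comm ≫ connecting f' = connecting f ≫ a⟦(1 : ℤ)⟧' :=
  (triangleMap f f' a b comm).comm₃.symm

theorem exists_connecting_comp {Z : CochainComplex C ℤ} (g : mappingCone f ⟶ Z)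
    (hg : inr f ≫ g = 0) : ∃ w, connecting f ≫ w = g := by
  let w (n : ℤ) : (K⟦(1 : ℤ)⟧).X n ⟶ Z.X n := -(K.shiftFunctorObjXIso 1 n (n + 1) rfl).hom ≫
    (inl f).v (n + 1) n (by lia) ≫ g.f n
  have hw (n : ℤ) : (connecting f).f n ≫ w n = g.f n := by
    rw [ext_from_iff _ (n + 1) n rfl, ← Category.assoc, inl_v_connecting_f, ← Category.assoc,
      inr_f_connecting_f, zero_comp]
    refine ⟨?_, (congrArg (fun t => HomologicalComplex.Hom.f t n) hg).symm⟩
    rw [Preadditive.neg_comp, Preadditive.comp_neg, neg_neg, Iso.inv_hom_id_assoc]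
  refine ⟨⟨w, fun n m _ => ?_⟩, ?_⟩
  · rw [← cancel_epi ((connecting f).f n), ← Category.assoc, hw, ← Category.assoc,
      (connecting f).comm, Category.assoc, hw, g.comm]
  · ext n
    exact hw n

theorem isPushout_connecting [HasZeroObject C] :
    IsPushout (inr f) (0 : L ⟶ 0) (connecting f) (0 : 0 ⟶ K⟦(1 : ℤ)⟧) where
  w := by rw [inr_connecting, zero_comp]
  isColimit' := ⟨PushoutCocone.IsColimit.mk _
    (fun s => (exists_connecting_comp f s.inl (by rw [s.condition, zero_comp])).choose)
    (fun s => (exists_connecting_comp f s.inl (by rw [s.condition, zero_comp])).choose_spec)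
    (fun s => (isZero_zero _).eq_of_src _ _)
    (fun s m h₁ h₂ => by
      rw [← cancel_epi (connecting f), h₁]
      exact (exists_connecting_comp f s.inl (by
        rw [s.condition, zero_comp])).choose_spec.symm)⟩

theorem mapConnecting {D : Type*} [Category* D] [Preadditive D] [HasBinaryBiproducts D]
    (G : C ⥤ D) [G.Additive] :
    (G.mapHomologicalComplex (ComplexShape.up ℤ)).map (connecting f) ≫
      ((G.mapHomologicalComplex (ComplexShape.up ℤ)).commShiftIso (1 : ℤ)).hom.app K =
    (mapHomologicalComplexIso f G).hom ≫
      connecting ((G.mapHomologicalComplex (ComplexShape.up ℤ)).map f) :=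
  map_δ f G

/-- A map homotopic to zero factors through the cone of the identity. -/
theorem exists_factor_of_homotopy {f g : K ⟶ L} (h : Homotopy f g) :
    ∃ w, f - g = inr (𝟙 K) ≫ w :=
  ⟨desc (𝟙 K) (Cochain.ofHomotopy h) (f - g) (by
    rw [δ_ofHomotopy, Category.id_comp, Cochain.ofHom_sub]), by simp⟩

/-- The cone of the identity has the lifting property against degreewise epimorphisms if
the complex consists of projective objects. -/
theorem exists_lift_of_epi [∀ n, Projective (K.X n)] {E X : CochainComplex C ℤ}
    (g : mappingCone (𝟙 K) ⟶ X) (e : E ⟶ X) [∀ n, Epi (e.f n)] : ∃ h, h ≫ e = g := by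
  let α : Cochain K X (-1) := (inl (𝟙 K)).comp (Cochain.ofHom g) (add_zero _)
  let α' : Cochain K E (-1) := Cochain.mk fun p q hpq =>
    Projective.factorThru (α.v p q hpq) (e.f q)
  have hα : α'.comp (Cochain.ofHom e) (add_zero _) = α := by
    ext p q hpq
    simp [α', Projective.factorThru_comp]
  let β : Cocycle K E 0 := Cocycle.mk (δ (-1) 0 α') 1 (by lia) (δ_δ _ _ _ _)
  refine ⟨desc (𝟙 K) α' (Cocycle.homOf β) (by simp [β]), ?_⟩
  ext n
  rw [ext_from_iff _ (n + 1) n rfl]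
  constructor
  · have := Cochain.congr_v hα (n + 1) n (by lia)
    simpa [α] using this
  · have h : Cochain.ofHom (Cocycle.homOf β ≫ e) = Cochain.ofHom (inr (𝟙 K) ≫ g) := by
      have h₁ := congrArg (δ (-1) 0) hα
      rw [δ_comp_ofHom] at h₁
      simp [β, h₁, α]
    have := congrArg (fun t => HomologicalComplex.Hom.f t n)
      (Cochain.ofHom_injective h)
    simpa using this

end CochainComplex.mappingCone

namespace TriMod

variable {𝕜 : Type u} [Field 𝕜]

/-- The morphism `p` is a cokernel of `i`. -/
structure IsCoker {M J S : TriMod 𝕜} (i : M ⟶ J) (p : J ⟶ S) : Prop where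
  zero : i ≫ p = 0
  epi : Epi p
  exists_desc : ∀ {Z : TriMod 𝕜} (g : J ⟶ Z), i ≫ g = 0 → ∃ w, p ≫ w = g

theorem isCoker_toSusp (M : TriMod 𝕜) : IsCoker (toCofree M) (toSusp M) :=
  ⟨toCofree_toSusp M, inferInstance, fun g hg => ⟨cokerDesc _ g hg, cokerπ_desc _ _ _⟩⟩

instance : HasCokernels (TriMod 𝕜) where
  has_colimit f := ⟨⟨_, CokernelCofork.IsColimit.ofπ (cokerπ f) (comp_cokerπ f)
    (fun g hg => cokerDesc f g hg) (fun g hg => cokerπ_desc f g hg)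
    (fun g hg m hm => by rw [← cancel_epi (cokerπ f), hm, cokerπ_desc])⟩⟩

instance : HasBinaryCoproducts (TriMod 𝕜) :=
  Adjunction.hasColimitsOfShape_of_equivalence (GInf 𝕜).inv

instance : HasPushouts (TriMod 𝕜) := by
  have : HasCoequalizers (TriMod 𝕜) := Preadditive.hasCoequalizers_of_hasCokernels
  exact hasPushouts_of_hasBinaryCoproducts_of_hasCoequalizers _

/-! ### Morphisms to coinduced modules -/

section

variable {V : ℤ → ℤ → ℤ → Type u} [∀ i j k, AddCommGroup (V i j k)] [∀ i j k, Module 𝕜 (V i j k)]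

/-- The evaluation at `1`. -/
def cofreeEval (i j k : ℤ) : CofreeX V i j k →ₗ[𝕜] V i j k where
  toFun x := x.e
  map_add' _ _ := rfl
  map_smul' _ _ := rfl

theorem cofree_hom_ext {M : TriMod 𝕜} {f g : M ⟶ cofree 𝕜 V}
    (h : ∀ i j k x, cofreeEval (𝕜 := 𝕜) (V := V) i j k (f.app i j k x) =
      cofreeEval (𝕜 := 𝕜) (V := V) i j k (g.app i j k x)) : f = g := by
  have h₁ {i j k} (x : M.X i j k) (f : M ⟶ cofree 𝕜 V) :
      (f.app _ _ _ (M.d1 j k rfl x) : CofreeX V (i + 1) j k) =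
        cofree1 (𝕜 := 𝕜) V i j k (f.app i j k x) := f.comm1 j k rfl x
  have h₂ {i j k} (x : M.X i j k) (f : M ⟶ cofree 𝕜 V) :
      (f.app _ _ _ (M.d2 i k rfl x) : CofreeX V i (j + 1) k) =
        cofree2 (𝕜 := 𝕜) V i j k (f.app i j k x) := f.comm2 i k rfl x
  have h₃ {i j k} (x : M.X i j k) (f : M ⟶ cofree 𝕜 V) :
      (f.app _ _ _ (M.d3 i j rfl x) : CofreeX V i j (k + 1)) =
        cofree3 (𝕜 := 𝕜) V i j k (f.app i j k x) := f.comm3 i j rfl x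
  have he {i j k} (x : M.X i j k) : CofreeX.e (f.app i j k x : CofreeX V i j k) =
    CofreeX.e (g.app i j k x : CofreeX V i j k) := h i j k x
  have ha1 {i j k} (x : M.X i j k) : CofreeX.a1 (f.app i j k x : CofreeX V i j k) =
      CofreeX.a1 (g.app i j k x : CofreeX V i j k) := by
    have h := he (M.d1 j k rfl x)
    simp only [h₁] at h
    exact h
  have ha2 {i j k} (x : M.X i j k) : CofreeX.a2 (f.app i j k x : CofreeX V i j k) =
      CofreeX.a2 (g.app i j k x : CofreeX V i j k) := by
    have h := he (M.d2 i k rfl x)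
    simp only [h₂] at h
    exact h
  have ha3 {i j k} (x : M.X i j k) : CofreeX.a3 (f.app i j k x : CofreeX V i j k) =
      CofreeX.a3 (g.app i j k x : CofreeX V i j k) := by
    have h := he (M.d3 i j rfl x)
    simp only [h₃] at h
    exact h
  have ha12 {i j k} (x : M.X i j k) : CofreeX.a12 (f.app i j k x : CofreeX V i j k) =
      CofreeX.a12 (g.app i j k x : CofreeX V i j k) := by
    have h := ha1 (M.d2 i k rfl x)
    simp only [h₂] at h
    exact h
  have ha13 {i j k} (x : M.X i j k) : CofreeX.a13 (f.app i j k x : CofreeX V i j k) =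
      CofreeX.a13 (g.app i j k x : CofreeX V i j k) := by
    have h := ha1 (M.d3 i j rfl x)
    simp only [h₃] at h
    exact h
  have ha23 {i j k} (x : M.X i j k) : CofreeX.a23 (f.app i j k x : CofreeX V i j k) =
      CofreeX.a23 (g.app i j k x : CofreeX V i j k) := by
    have h := ha2 (M.d3 i j rfl x)
    simp only [h₃] at h
    exact h
  have ha123 {i j k} (x : M.X i j k) : CofreeX.a123 (f.app i j k x : CofreeX V i j k) =
      CofreeX.a123 (g.app i j k x : CofreeX V i j k) := by
    have h := ha12 (M.d3 i j rfl x)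
    simp only [h₃] at h
    exact h
  ext i j k x
  exact CofreeX.ext (he x) (ha1 x) (ha2 x) (ha3 x) (ha12 x) (ha13 x) (ha23 x) (ha123 x)

/-- Morphisms to a coinduced module extend along degreewise split monomorphisms. -/
theorem exists_extension_cofree {M J : TriMod 𝕜} (i : M ⟶ J)
    (s : ∀ i j k, J.X i j k →ₗ[𝕜] M.X i j k) (hs : ∀ a b c x, s a b c (i.app a b c x) = x)
    (g : M ⟶ cofree 𝕜 V) : ∃ h, i ≫ h = g := by
  refine ⟨toCofree J ≫ cofreeMap fun a b c => cofreeEval a b c ∘ₗ g.app a b c ∘ₗ s a b c,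
    cofree_hom_ext fun a b c x => ?_⟩
  exact congrArg (fun y => cofreeEval (𝕜 := 𝕜) (V := V) a b c (g.app a b c y)) (hs a b c x)

/-- Morphisms to a projective module extend along degreewise split monomorphisms. -/
theorem exists_extension_projective {M J P : TriMod 𝕜} [Projective P] (i : M ⟶ J)
    (s : ∀ i j k, J.X i j k →ₗ[𝕜] M.X i j k) (hs : ∀ a b c x, s a b c (i.app a b c x) = x)
    (g : M ⟶ P) : ∃ h, i ≫ h = g := by
  have := epi_fromCofree_unshift P
  obtain ⟨h, hh⟩ := exists_extension_cofree i s hs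
    (g ≫ Projective.factorThru (𝟙 P) (fromCofree P (unshift P)))
  refine ⟨h ≫ fromCofree P (unshift P), ?_⟩
  rw [← Category.assoc, hh, Category.assoc, Projective.factorThru_comp, Category.comp_id]

end

/-- Morphisms to a projective module extend along the embedding into the coinduced module. -/
theorem exists_extension_toCofree {M P : TriMod 𝕜} [Projective P] (g : M ⟶ P) :
    ∃ h, toCofree M ≫ h = g :=
  exists_extension_projective (toCofree M) (fun i j k => cofreeEval i j k) (fun _ _ _ _ => rfl) g

/-! ### Comparison in the stable category -/

theorem proj_map_eq_of_sub_eq {M N P : TriMod 𝕜} [hP : Projective P] {f g : M ⟶ N} (a : M ⟶ P)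
    (b : P ⟶ N) (h : f - g = a ≫ b) : (StabMod.proj 𝕜).map f = (StabMod.proj 𝕜).map g :=
  CategoryTheory.Quotient.sound _ ⟨P, hP, a, b, h⟩

theorem IsCoker.proj_map_eq {M J S J' S' : TriMod 𝕜} {i : M ⟶ J} {p : J ⟶ S} (h : IsCoker i p)
    [Projective J'] {q : J' ⟶ S'} {a b : S ⟶ S'} (A B : J ⟶ J') (ha : p ≫ a = A ≫ q)
    (hb : p ≫ b = B ≫ q) (hi : i ≫ A = i ≫ B) :
    (StabMod.proj 𝕜).map a = (StabMod.proj 𝕜).map b := by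
  have := h.epi
  obtain ⟨w, hw⟩ := h.exists_desc (A - B) (by rw [Preadditive.comp_sub, hi, sub_self])
  refine proj_map_eq_of_sub_eq w q ?_
  rw [← cancel_epi p, Preadditive.comp_sub, ha, hb, ← Preadditive.sub_comp, ← hw, Category.assoc]

theorem proj_map_pushout_eq_id {M N J S C : TriMod 𝕜} [Projective J] {f : M ⟶ N} {i : M ⟶ J}
    {p : J ⟶ S} (h : IsCoker i p) {c : N ⟶ C} {e : J ⟶ C} (hC : IsPushout f i c e) {δ : C ⟶ S}
    (hc : c ≫ δ = 0) (he : e ≫ δ = p) (a : C ⟶ C) (r : J ⟶ J) (hr : i ≫ r = i)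
    (h₁ : c ≫ a = c) (h₂ : e ≫ a = r ≫ e) :
    (StabMod.proj 𝕜).map a = 𝟙 _ := by
  obtain ⟨w, hw⟩ := h.exists_desc (r - 𝟙 J) (by
    rw [Preadditive.comp_sub, hr, Category.comp_id, sub_self])
  rw [← (StabMod.proj 𝕜).map_id]
  refine proj_map_eq_of_sub_eq (δ ≫ w) e (hC.hom_ext ?_ ?_)
  · rw [Preadditive.comp_sub, h₁, Category.comp_id, sub_self, Category.assoc, ← Category.assoc, hc,
      zero_comp]
  · rw [Preadditive.comp_sub, h₂, Category.comp_id, Category.assoc, ← Category.assoc, he,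
      ← Category.assoc, hw, Preadditive.sub_comp, Category.id_comp]

/-- The cones formed with two embeddings of `M` into projective modules are stably isomorphic. -/
theorem exists_iso_of_isPushout {M N J S C J' S' C' : TriMod 𝕜} [Projective J] [Projective J']
    {f : M ⟶ N} {i : M ⟶ J} {p : J ⟶ S} (h : IsCoker i p) {i' : M ⟶ J'} {p' : J' ⟶ S'}
    (h' : IsCoker i' p') {c : N ⟶ C} {e : J ⟶ C} (hC : IsPushout f i c e) {c' : N ⟶ C'}
    {e' : J' ⟶ C'} (hC' : IsPushout f i' c' e') {δ : C ⟶ S} (hc : c ≫ δ = 0) (he : e ≫ δ = p)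
    {δ' : C' ⟶ S'} (hc' : c' ≫ δ' = 0) (he' : e' ≫ δ' = p') {t : J ⟶ J'} (ht : i ≫ t = i')
    {t' : J' ⟶ J} (ht' : i' ≫ t' = i) {s : S ⟶ S'} (hs : p ≫ s = t ≫ p') :
    ∃ γ : (StabMod.proj 𝕜).obj C ≅ (StabMod.proj 𝕜).obj C',
      (StabMod.proj 𝕜).map c ≫ γ.hom = (StabMod.proj 𝕜).map c' ∧
      (StabMod.proj 𝕜).map δ ≫ (StabMod.proj 𝕜).map s = γ.hom ≫ (StabMod.proj 𝕜).map δ' := by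
  let g : C ⟶ C' := hC.desc c' (t ≫ e') (by rw [hC'.w, ← ht, Category.assoc])
  let g' : C' ⟶ C := hC'.desc c (t' ≫ e) (by rw [hC.w, ← ht', Category.assoc])
  have hg₁ : c ≫ g = c' := hC.inl_desc _ _ _
  have hg₂ : e ≫ g = t ≫ e' := hC.inr_desc _ _ _
  have hg₁' : c' ≫ g' = c := hC'.inl_desc _ _ _
  have hg₂' : e' ≫ g' = t' ≫ e := hC'.inr_desc _ _ _
  refine ⟨⟨(StabMod.proj 𝕜).map g, (StabMod.proj 𝕜).map g', ?_, ?_⟩, ?_, ?_⟩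
  · rw [← Functor.map_comp]
    refine proj_map_pushout_eq_id h hC hc he _ (t ≫ t') ?_ ?_ ?_
    · rw [← Category.assoc, ht, ht']
    · rw [← Category.assoc, hg₁, hg₁']
    · rw [← Category.assoc, hg₂, Category.assoc, hg₂', Category.assoc]
  · rw [← Functor.map_comp]
    refine proj_map_pushout_eq_id h' hC' hc' he' _ (t' ≫ t) ?_ ?_ ?_
    · rw [← Category.assoc, ht', ht]
    · rw [← Category.assoc, hg₁', hg₁]
    · rw [← Category.assoc, hg₂', Category.assoc, hg₂, Category.assoc]
  · rw [← Functor.map_comp, hg₁]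
  · rw [← Functor.map_comp, ← Functor.map_comp]
    refine congrArg _ (hC.hom_ext ?_ ?_)
    · rw [← Category.assoc, hc, zero_comp, ← Category.assoc, hg₁, hc']
    · rw [← Category.assoc, he, hs, ← Category.assoc, hg₂, Category.assoc, he']

end TriMod

namespace GInf

variable {𝕜 : Type u} [Field 𝕜]

open TriMod CochainComplex.mappingCone

theorem epi_f {X Y : CochainComplex (GrMod 𝕜) ℤ} (f : X ⟶ Y) [Epi f] (n : ℤ) : Epi (f.f n) := by
  refine GrMod.epi_of_surjective _ ?_
  rw [← LinearMap.range_eq_top, eq_top_iff, ← (Y.X n).iSup_part]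
  refine iSup_le fun p y hy => ?_
  obtain ⟨x, hx⟩ := surjective_of_epi ((GInf 𝕜).map f) p.1 p.2 n ⟨y, hy⟩
  exact ⟨x.1, congrArg Subtype.val hx⟩

variable (X : CochainComplex (GrMod 𝕜) ℤ) {Y : CochainComplex (GrMod 𝕜) ℤ}

/-- The image under `𝓖_∞` of the cone of the identity of `X`. -/
noncomputable abbrev cone : TriMod 𝕜 := (GInf 𝕜).obj (CochainComplex.mappingCone (𝟙 X))

/-- The embedding of `𝓖_∞(X)` into the image of the cone of the identity. -/
noncomputable abbrev toCone : (GInf 𝕜).obj X ⟶ cone X := (GInf 𝕜).map (inr (𝟙 X))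

/-- The projection of the image of the cone of the identity to `𝓖_∞(X[1])`. -/
noncomputable abbrev coneToShift : cone X ⟶ (GInf 𝕜).obj (X⟦(1 : ℤ)⟧) :=
  (GInf 𝕜).map (connecting (𝟙 X))

instance cone_projective [∀ n, Projective (X.X n)] : Projective (cone X) := by
  have : Projective (CochainComplex.mappingCone (𝟙 X)) :=
    ⟨fun f e _ => by
      have := epi_f e
      exact exists_lift_of_epi f e⟩
  exact ((GInf 𝕜).asEquivalence.map_projective_iff _).2 this

theorem isCoker_coneToShift : IsCoker (toCone X) (coneToShift X) where
  zero := by rw [← Functor.map_comp, inr_connecting, Functor.map_zero]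
  epi := inferInstance
  exists_desc g hg := by
    have h := (isPushout_connecting (𝟙 X)).map (GInf 𝕜)
    exact ⟨h.desc g 0 (by rw [hg, Functor.map_zero, zero_comp]), h.inl_desc _ _ _⟩

theorem toCone_split : ∃ s : ∀ i j k, (cone X).X i j k →ₗ[𝕜] ((GInf 𝕜).obj X).X i j k,
    ∀ i j k x, s i j k ((toCone X).app i j k x) = x :=
  ⟨fun _ _ k => ((snd (𝟙 X)).v k k (add_zero k)).lin.restrict fun _ hm => GrMod.Hom.map_part _ hm,
    fun _ _ k x => Subtype.ext
      (congrArg (fun t => GrMod.Hom.lin t x.1) (inr_f_snd_v (𝟙 X) k))⟩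

theorem exists_coneToCofree : ∃ t, toCone X ≫ t = toCofree ((GInf 𝕜).obj X) := by
  obtain ⟨s, hs⟩ := toCone_split X
  exact exists_extension_cofree _ s hs _

/-- A morphism from the image of the cone to the coinduced module, compatible with the embeddings
of `𝓖_∞(X)`. -/
noncomputable def coneToCofree : cone X ⟶ cofree 𝕜 ((GInf 𝕜).obj X).X :=
  (exists_coneToCofree X).choose

theorem toCone_coneToCofree : toCone X ≫ coneToCofree X = toCofree ((GInf 𝕜).obj X) :=
  (exists_coneToCofree X).choose_spec

theorem exists_shiftToSusp :
    ∃ s, coneToShift X ≫ s = coneToCofree X ≫ toSusp ((GInf 𝕜).obj X) :=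
  (isCoker_coneToShift X).exists_desc _ (by
    rw [← Category.assoc, toCone_coneToCofree, toCofree_toSusp])

/-- The comparison of `𝓖_∞(X[1])` with the suspension of `𝓖_∞(X)`. -/
noncomputable def shiftToSusp : (GInf 𝕜).obj (X⟦(1 : ℤ)⟧) ⟶ susp ((GInf 𝕜).obj X) :=
  (exists_shiftToSusp X).choose

theorem coneToShift_shiftToSusp :
    coneToShift X ≫ shiftToSusp X = coneToCofree X ≫ toSusp ((GInf 𝕜).obj X) :=
  (exists_shiftToSusp X).choose_spec

variable {X} in
theorem shiftToSusp_naturality (f : X ⟶ Y) :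
    (StabMod.proj 𝕜).map ((GInf 𝕜).map (f⟦(1 : ℤ)⟧') ≫ shiftToSusp Y) =
      (StabMod.proj 𝕜).map (shiftToSusp X ≫ suspMap ((GInf 𝕜).map f)) := by
  refine (isCoker_coneToShift X).proj_map_eq
    ((GInf 𝕜).map (CochainComplex.mappingCone.map (𝟙 X) (𝟙 Y) f f (by simp)) ≫ coneToCofree Y)
    (coneToCofree X ≫ cofreeMap ((GInf 𝕜).map f).app) (q := toSusp _) ?_ ?_ ?_
  · rw [Category.assoc, ← coneToShift_shiftToSusp, ← Category.assoc, ← Category.assoc,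
      ← Functor.map_comp, ← Functor.map_comp, map_connecting]
  · rw [← Category.assoc, coneToShift_shiftToSusp, Category.assoc, toSusp_suspMap, Category.assoc]
  · have h : inr (𝟙 X) ≫ CochainComplex.mappingCone.map (𝟙 X) (𝟙 Y) f f (by simp) = f ≫ inr (𝟙 Y) := by
      simp [CochainComplex.mappingCone.map]
    rw [← Category.assoc, ← Functor.map_comp, h, Functor.map_comp, Category.assoc,
      toCone_coneToCofree, toCofree_naturality, ← Category.assoc, toCone_coneToCofree]

theorem exists_cofreeToCone [∀ n, Projective (X.X n)] :
    ∃ t', toCofree ((GInf 𝕜).obj X) ≫ t' = toCone X :=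
  exists_extension_toCofree _

instance isIso_shiftToSusp [∀ n, Projective (X.X n)] :
    IsIso ((StabMod.proj 𝕜).map (shiftToSusp X)) := by
  obtain ⟨t', ht'⟩ := exists_cofreeToCone X
  obtain ⟨s', hs'⟩ := (isCoker_toSusp ((GInf 𝕜).obj X)).exists_desc (t' ≫ coneToShift X) (by
    rw [← Category.assoc, ht', (isCoker_coneToShift X).zero])
  refine ⟨(StabMod.proj 𝕜).map s', ?_, ?_⟩
  · rw [← Functor.map_comp, ← (StabMod.proj 𝕜).map_id]
    refine (isCoker_coneToShift X).proj_map_eq (coneToCofree X ≫ t') (𝟙 _)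
      (q := coneToShift X) ?_ ?_ ?_
    · rw [← Category.assoc, coneToShift_shiftToSusp, Category.assoc, hs', Category.assoc]
    · rw [Category.comp_id, Category.id_comp]
    · rw [← Category.assoc, toCone_coneToCofree, ht', Category.comp_id]
  · rw [← Functor.map_comp, ← (StabMod.proj 𝕜).map_id]
    refine (isCoker_toSusp _).proj_map_eq (t' ≫ coneToCofree X) (𝟙 _) (q := toSusp _) ?_ ?_ ?_
    · rw [← Category.assoc, hs', Category.assoc, coneToShift_shiftToSusp, Category.assoc]
    · rw [Category.comp_id, Category.id_comp]
    · rw [← Category.assoc, ht', toCone_coneToCofree, Category.comp_id]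

variable {X} in
/-- The triangle of a mapping cone is sent to a distinguished triangle. -/
theorem isDistinguished_mappingCone [∀ n, Projective (X.X n)] (f : X ⟶ Y) :
    StabMod.IsDistinguished ((GInf 𝕜 ⋙ StabMod.proj 𝕜).map f)
      ((GInf 𝕜 ⋙ StabMod.proj 𝕜).map (inr f))
      ((GInf 𝕜 ⋙ StabMod.proj 𝕜).map (connecting f) ≫ (StabMod.proj 𝕜).map (shiftToSusp X)) := by
  obtain ⟨t', ht'⟩ := exists_cofreeToCone X
  have hC := (isPushout_map f).map (GInf 𝕜)
  have hC' := IsPushout.of_hasPushout ((GInf 𝕜).map f) (toCofree ((GInf 𝕜).obj X))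
  let δ' := hC'.desc 0 (toSusp ((GInf 𝕜).obj X)) (by rw [comp_zero, toCofree_toSusp])
  have hc' : pushout.inl _ _ ≫ δ' = 0 := hC'.inl_desc _ _ _
  have he' : pushout.inr _ _ ≫ δ' = toSusp _ := hC'.inr_desc _ _ _
  have hc : (GInf 𝕜).map (inr f) ≫ (GInf 𝕜).map (connecting f) = 0 := by
    rw [← Functor.map_comp, inr_connecting, Functor.map_zero]
  have he : (GInf 𝕜).map (CochainComplex.mappingCone.map (𝟙 X) f (𝟙 X) f (by simp)) ≫ (GInf 𝕜).map (connecting f) =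
      coneToShift X := by
    rw [← Functor.map_comp, map_connecting, CategoryTheory.Functor.map_id, Category.comp_id]
  obtain ⟨γ, h₁, h₂⟩ := exists_iso_of_isPushout (isCoker_coneToShift X)
    (isCoker_toSusp ((GInf 𝕜).obj X)) hC hC' hc he hc' he' (toCone_coneToCofree X) ht'
    (coneToShift_shiftToSusp X)
  refine ⟨_, _, _, _, _, _, δ', Iso.refl _, Iso.refl _, γ, hC', hc', he', ?_, ?_, ?_⟩
  · exact (Category.comp_id _).trans (Category.id_comp _).symm
  · exact h₁.trans (Category.id_comp _).symm
  · exact (congrArg (_ ≫ ·) ((StabMod.shift 𝕜).map_id _)).trans ((Category.comp_id _).trans h₂)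

end GInf

namespace StabMod

variable {𝕜 : Type u} [Field 𝕜]

theorem IsDistinguished.of_iso {X Y Z X' Y' Z' : StabMod 𝕜} {u : X ⟶ Y} {v : Y ⟶ Z}
    {w : Z ⟶ (shift 𝕜).obj X} (h : IsDistinguished u v w) {u' : X' ⟶ Y'} {v' : Y' ⟶ Z'}
    {w' : Z' ⟶ (shift 𝕜).obj X'} (α : X' ≅ X) (β : Y' ≅ Y) (γ : Z' ≅ Z)
    (hu : u' ≫ β.hom = α.hom ≫ u) (hv : v' ≫ γ.hom = β.hom ≫ v)
    (hw : w' ≫ (shift 𝕜).map α.hom = γ.hom ≫ w) : IsDistinguished u' v' w' := by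
  obtain ⟨M, N, C, f, c, e, δ, α', β', γ', h₁, h₂, h₃, h₄, h₅, h₆⟩ := h
  refine ⟨M, N, C, f, c, e, δ, α ≪≫ α', β ≪≫ β', γ ≪≫ γ', h₁, h₂, h₃, ?_, ?_, ?_⟩
  · rw [Iso.trans_hom, Iso.trans_hom, ← Category.assoc, hu, Category.assoc, h₄, Category.assoc]
  · rw [Iso.trans_hom, Iso.trans_hom, ← Category.assoc, hv, Category.assoc, h₅, Category.assoc]
  · rw [Iso.trans_hom, Iso.trans_hom, Functor.map_comp, ← Category.assoc, hw, Category.assoc, h₆,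
      Category.assoc]
    rfl

end StabMod

namespace GInf

variable (𝕜 : Type u) [Field 𝕜]

open CochainComplex.mappingCone

/-- The inclusion of complexes of graded projective modules into complexes of graded modules. -/
noncomputable abbrev inclProj :
    CochainComplex (GrMod.Proj 𝕜) ℤ ⥤ CochainComplex (GrMod 𝕜) ℤ :=
  (isProjective (GrMod 𝕜)).ι.mapHomologicalComplex (ComplexShape.up ℤ)

instance inclProj_projective (K : CochainComplex (GrMod.Proj 𝕜) ℤ) (n : ℤ) :
    Projective (((inclProj 𝕜).obj K).X n) :=
  (K.X n).property

variable {𝕜} in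
theorem stable_map_eq_of_homotopy {K L : CochainComplex (GrMod.Proj 𝕜) ℤ} {f g : K ⟶ L}
    (h : Homotopy f g) : (inclProj 𝕜 ⋙ GInf 𝕜 ⋙ StabMod.proj 𝕜).map f =
      (inclProj 𝕜 ⋙ GInf 𝕜 ⋙ StabMod.proj 𝕜).map g := by
  obtain ⟨w, hw⟩ := exists_factor_of_homotopy
    ((isProjective (GrMod 𝕜)).ι.mapHomotopy h)
  refine TriMod.proj_map_eq_of_sub_eq (toCone _) ((GInf 𝕜).map w) ?_
  rw [← Functor.map_comp, ← hw, Functor.map_sub]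

/-- The functor `𝓖` from the homotopy category of complexes of graded projective modules to the
stable category of trigraded `Λ₃`-modules. -/
noncomputable def stable :
    HomotopyCategory (GrMod.Proj 𝕜) (ComplexShape.up ℤ) ⥤ StabMod 𝕜 :=
  CategoryTheory.Quotient.lift _ (inclProj 𝕜 ⋙ GInf 𝕜 ⋙ StabMod.proj 𝕜)
    fun _ _ _ _ ⟨h⟩ => stable_map_eq_of_homotopy h

theorem quotient_comp_stable :
    HomotopyCategory.quotient (GrMod.Proj 𝕜) (ComplexShape.up ℤ) ⋙ stable 𝕜 =
      inclProj 𝕜 ⋙ GInf 𝕜 ⋙ StabMod.proj 𝕜 :=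
  CategoryTheory.Quotient.lift_spec _ _ _

instance stable_additive : (stable 𝕜).Additive := by
  have : (HomotopyCategory.quotient (GrMod.Proj 𝕜) (ComplexShape.up ℤ) ⋙ stable 𝕜).Additive := by
    rw [quotient_comp_stable]
    infer_instance
  exact Functor.additive_of_full_essSurj_comp
    (HomotopyCategory.quotient (GrMod.Proj 𝕜) (ComplexShape.up ℤ)) _

/-- The comparison of shifts for complexes of graded projective modules. -/
noncomputable def shiftIso (K : CochainComplex (GrMod.Proj 𝕜) ℤ) :
    (inclProj 𝕜 ⋙ GInf 𝕜 ⋙ StabMod.proj 𝕜).obj (K⟦(1 : ℤ)⟧) ≅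
      (inclProj 𝕜 ⋙ GInf 𝕜 ⋙ StabMod.proj 𝕜 ⋙ StabMod.shift 𝕜).obj K :=
  (GInf 𝕜 ⋙ StabMod.proj 𝕜).mapIso (((inclProj 𝕜).commShiftIso (1 : ℤ)).app K) ≪≫
    @asIso _ _ _ _ _ (isIso_shiftToSusp ((inclProj 𝕜).obj K))

theorem shiftIso_hom (K : CochainComplex (GrMod.Proj 𝕜) ℤ) : (shiftIso 𝕜 K).hom =
    (GInf 𝕜 ⋙ StabMod.proj 𝕜).map (((inclProj 𝕜).commShiftIso (1 : ℤ)).hom.app K) ≫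
      (StabMod.proj 𝕜).map (shiftToSusp ((inclProj 𝕜).obj K)) := rfl

/-- The natural comparison of shifts on complexes of graded projective modules. -/
noncomputable def shiftNatIso :
    shiftFunctor (CochainComplex (GrMod.Proj 𝕜) ℤ) (1 : ℤ) ⋙
      inclProj 𝕜 ⋙ GInf 𝕜 ⋙ StabMod.proj 𝕜 ≅
        inclProj 𝕜 ⋙ GInf 𝕜 ⋙ StabMod.proj 𝕜 ⋙ StabMod.shift 𝕜 :=
  NatIso.ofComponents (shiftIso 𝕜) fun {K L} f => by
    have h₁ := ((inclProj 𝕜).commShiftIso (1 : ℤ)).hom.naturality f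
    have h₂ := shiftToSusp_naturality ((inclProj 𝕜).map f)
    have h₃ := congrArg (GInf 𝕜 ⋙ StabMod.proj 𝕜).map h₁
    rw [Functor.map_comp, Functor.map_comp] at h₂ h₃
    change (GInf 𝕜 ⋙ StabMod.proj 𝕜).map ((inclProj 𝕜).map (f⟦(1 : ℤ)⟧')) ≫ _ = _
    rw [shiftIso_hom, shiftIso_hom]
    refine (Category.assoc _ _ _).symm.trans ((congrArg (· ≫ _) h₃).trans ?_)
    refine (Category.assoc _ _ _).trans ?_
    exact (congrArg (_ ≫ ·) h₂).trans (Category.assoc _ _ _).symm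

/-- The natural isomorphism `𝓖(M[1]) ≅ 𝓖(M)[1]`. -/
noncomputable def stableShiftIso :
    shiftFunctor (HomotopyCategory (GrMod.Proj 𝕜) (ComplexShape.up ℤ)) (1 : ℤ) ⋙ stable 𝕜 ≅
      stable 𝕜 ⋙ StabMod.shift 𝕜 :=
  CategoryTheory.Quotient.natIsoLift _
    (Functor.isoWhiskerRight ((HomotopyCategory.quotient (GrMod.Proj 𝕜)
      (ComplexShape.up ℤ)).commShiftIso (1 : ℤ)).symm (stable 𝕜) ≪≫ shiftNatIso 𝕜)

theorem stableShiftIso_hom_app (K : CochainComplex (GrMod.Proj 𝕜) ℤ) :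
    (stableShiftIso 𝕜).hom.app ((HomotopyCategory.quotient _ _).obj K) =
      (stable 𝕜).map (((HomotopyCategory.quotient (GrMod.Proj 𝕜)
        (ComplexShape.up ℤ)).commShiftIso (1 : ℤ)).inv.app K) ≫ (shiftIso 𝕜 K).hom := rfl

theorem stable_map_quotient_map {K L : CochainComplex (GrMod.Proj 𝕜) ℤ} (g : L ⟶ K⟦(1 : ℤ)⟧) :
    (stable 𝕜).map ((HomotopyCategory.quotient _ _).map g ≫
      ((HomotopyCategory.quotient (GrMod.Proj 𝕜) (ComplexShape.up ℤ)).commShiftIso (1 : ℤ)).hom.app K) ≫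
        (stableShiftIso 𝕜).hom.app ((HomotopyCategory.quotient _ _).obj K) =
      (inclProj 𝕜 ⋙ GInf 𝕜 ⋙ StabMod.proj 𝕜).map g ≫ (shiftIso 𝕜 K).hom := by
  have h : (stable 𝕜).map
      (((HomotopyCategory.quotient (GrMod.Proj 𝕜) (ComplexShape.up ℤ)).commShiftIso
        (1 : ℤ)).hom.app K) ≫ (stableShiftIso 𝕜).hom.app ((HomotopyCategory.quotient _ _).obj K) =
      (shiftIso 𝕜 K).hom := by
    rw [stableShiftIso_hom_app]
    refine (Category.assoc _ _ _).symm.trans ?_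
    refine (congrArg (· ≫ _) (((stable 𝕜).map_comp _ _).symm.trans
      ((congrArg (stable 𝕜).map (Iso.hom_inv_id_app _ K)).trans ((stable 𝕜).map_id _)))).trans ?_
    exact Category.id_comp _
  rw [Functor.map_comp]
  exact (Category.assoc _ _ _).trans (congrArg (_ ≫ ·) h)

theorem isDistinguished_triangleh {K L : CochainComplex (GrMod.Proj 𝕜) ℤ} (f : K ⟶ L) :
    StabMod.IsDistinguished ((stable 𝕜).map (triangleh f).mor₁) ((stable 𝕜).map (triangleh f).mor₂)
      ((stable 𝕜).map (triangleh f).mor₃ ≫ (stableShiftIso 𝕜).hom.app (triangleh f).obj₁) := by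
  refine (isDistinguished_mappingCone ((inclProj 𝕜).map f)).of_iso (Iso.refl _) (Iso.refl _)
    ((GInf 𝕜 ⋙ StabMod.proj 𝕜).mapIso (mapHomologicalComplexIso f _)) ?_ ?_ ?_
  · exact (Category.comp_id _).trans (Category.id_comp _).symm
  · refine Eq.trans ?_ (Category.id_comp _).symm
    have h := congrArg (GInf 𝕜 ⋙ StabMod.proj 𝕜).map (map_inr f (isProjective (GrMod 𝕜)).ι)
    rw [Functor.map_comp] at h
    exact h
  · have h := congrArg (GInf 𝕜 ⋙ StabMod.proj 𝕜).map
      (mapConnecting f (isProjective (GrMod 𝕜)).ι)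
    rw [Functor.map_comp, Functor.map_comp] at h
    refine (congrArg (_ ≫ ·) ((StabMod.shift 𝕜).map_id _)).trans ((Category.comp_id _).trans ?_)
    refine (stable_map_quotient_map 𝕜 (connecting f)).trans ?_
    rw [shiftIso_hom]
    refine (Category.assoc _ _ _).symm.trans ((congrArg (· ≫ _) h).trans ?_)
    exact Category.assoc _ _ _

theorem isDistinguished_of_mem
    (T : Pretriangulated.Triangle (HomotopyCategory (GrMod.Proj 𝕜) (ComplexShape.up ℤ)))
    (hT : T ∈ Pretriangulated.distinguishedTriangles) :
    StabMod.IsDistinguished ((stable 𝕜).map T.mor₁) ((stable 𝕜).map T.mor₂)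
      ((stable 𝕜).map T.mor₃ ≫ (stableShiftIso 𝕜).hom.app T.obj₁) := by
  obtain ⟨K, L, f, ⟨e⟩⟩ := hT
  refine (isDistinguished_triangleh 𝕜 f).of_iso
    ((stable 𝕜).mapIso (Pretriangulated.Triangle.π₁.mapIso e))
    ((stable 𝕜).mapIso (Pretriangulated.Triangle.π₂.mapIso e))
    ((stable 𝕜).mapIso (Pretriangulated.Triangle.π₃.mapIso e)) ?_ ?_ ?_
  · exact ((stable 𝕜).map_comp _ _).symm.trans
      ((congrArg (stable 𝕜).map e.hom.comm₁).trans ((stable 𝕜).map_comp _ _))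
  · exact ((stable 𝕜).map_comp _ _).symm.trans
      ((congrArg (stable 𝕜).map e.hom.comm₂).trans ((stable 𝕜).map_comp _ _))
  · have h := (stableShiftIso 𝕜).hom.naturality e.hom.hom₁
    have h₃ := congrArg (stable 𝕜).map e.hom.comm₃
    rw [Functor.map_comp, Functor.map_comp] at h₃
    refine (Category.assoc _ _ _).trans ((congrArg (_ ≫ ·) h.symm).trans ?_)
    refine (Category.assoc _ _ _).symm.trans ((congrArg (· ≫ _) h₃).trans ?_)
    exact Category.assoc _ _ _

end GInf

/-- The functor `𝓖_∞` from graded dg modules over `(A,d)` to `𝓜₃` is an equivalence, and it descends to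
a functor `G` from the homotopy category of complexes of graded projective `A`-modules to `𝓢𝓜₃`,
which is exact: it is additive, it commutes with the shifts up to a natural isomorphism `φ`,
and, through `φ`, it takes distinguished triangles to distinguished triangles. -/
theorem mainTheorem8 (𝕜 : Type u) [Field 𝕜] :
    (GInf 𝕜).IsEquivalence ∧
    ∃ G : HomotopyCategory (GrMod.Proj 𝕜) (ComplexShape.up ℤ) ⥤ StabMod 𝕜,
      HomotopyCategory.quotient (GrMod.Proj 𝕜) (ComplexShape.up ℤ) ⋙ G =
        (isProjective (GrMod 𝕜)).ι.mapHomologicalComplex (ComplexShape.up ℤ) ⋙ GInf 𝕜 ⋙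
          StabMod.proj 𝕜 ∧
      G.Additive ∧
      ∃ φ : shiftFunctor (HomotopyCategory (GrMod.Proj 𝕜) (ComplexShape.up ℤ)) (1 : ℤ) ⋙ G ≅
          G ⋙ StabMod.shift 𝕜,
        ∀ T ∈ Pretriangulated.distinguishedTriangles
            (C := HomotopyCategory (GrMod.Proj 𝕜) (ComplexShape.up ℤ)),
          StabMod.IsDistinguished (G.map T.mor₁) (G.map T.mor₂)
            (G.map T.mor₃ ≫ φ.hom.app T.obj₁) :=
  ⟨inferInstance, GInf.stable 𝕜, GInf.quotient_comp_stable 𝕜, inferInstance,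
    GInf.stableShiftIso 𝕜, GInf.isDistinguished_of_mem 𝕜⟩
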